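/- **Setting.** Let $n,d\ge 1$, let $X\in\mathbb R^{n\times d}$ be a fixed design matrix with rows $x_1',\dots,x_n'$, $\|X\|_\infty=\max_{i,j}|X_{ij}|$, and $\theta_\star\in\mathbb R^d$. Let $Z_1,\dots,Z_n$ be independent $0$-$1$ random variables with $\mathbb P(Z_i=1)=e^{\langle x_i,\theta_\star\rangle}/(1+e^{\langle x_i,\theta_\star\rangle})$, and let $\mathbb E^{(n)}$ denote the expectation. Put $g(x)=\log(1+e^x)$. For $\delta\in\{0,1\}^d$ with $\|\delta\|_0=\sum_j\delta_j$, let $\Pi(\cdot\mid\delta)$ be the law on $\mathbb R^d$ of independent coordinates $\theta_j$, where $\theta_j=0$ if $\delta_j=0$ and $\theta_j$ has density $\frac{\rho}{2}e^{-\rho|x|}$ if $\delta_j=1$; here $\rho=4\|X\|_\infty\sqrt{n\log d}$. The prior is $\Pi=\sum_\delta\pi_\delta\Pi(\cdot\mid\delta)$ and the posterior is $$\check\Pi_{n,d}(B\mid Z)=\frac{\int_B q_\theta(Z)\,\Pi(d\theta)}{\int_{\mathbb R^d}q_\theta(Z)\,\Pi(d\theta)},\qquad q_\theta(z)=\exp\Big(\sum_{i=1}^n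 \big(z_i\langle x_i,\theta\rangle-g(\langle x_i,\theta\rangle)\big)\Big).$$ The prior weights satisfy, with constants $c_1,c_2>0$ and $c_3\ge c_4>0$, $$\pi_\delta=g_{\|\delta\|_0}\binom{d}{\|\delta\|_0}^{-1},\qquad \frac{c_1}{d^{c_3}}g_{s-1}\le g_s\le\frac{c_2}{d^{c_4}}g_{s-1}\quad(1\le s\le d)\qquad\text{(H2)}$$ for a probability distribution $(g_s)_{0\le s\le d}$ on $\{0,\dots,d\}$. Let $\|\theta\|_0$ be the number of non-zero coordinates of $\theta$, $s_\star=\|\theta_\star\|_0$, $S_\star=\{j:\theta_{\star j}\ne0\}$, and $W=\mathrm{diag}\big(g''(\langle x_i,\theta_\star\rangle)\big)_{1\le i\le n}$. Define $$\underline\kappa_1=\inf\Big\{\tfrac{\theta'(X'WX)\theta}{n\|\theta\|_2^2}:\theta\ne0,\ \sum_{j\notin S_\star}|\theta_j|\le7\sum_{j\in S_\star}|\theta_j|\Big\}\qquad(\inf\emptyset=+\infty),$$ $$\underline\kappa_1(s)=\inf\Big\{\tfrac{\theta'(X'WX)\theta}{n\|\theta\|_2^2}:1\le\|\theta\|_0\le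 s\Big\},\qquad \bar\kappa_1(s)=\sup\Big\{\tfrac{\theta'(X'X)\theta}{n\|\theta\|_2^2}:1\le\|\theta\|_0\le s\Big\},$$ $$\zeta=s_\star+\frac2{c_4}+\frac2{c_4}\Big(1+\frac{64\|X\|_\infty^2}{\underline\kappa_1}+\frac{\bar\kappa_1(s_\star)}{64\|X\|_\infty^2(\log d)^2}+\frac{\log(4e)}{\log d}\Big)s_\star$$ (the last term being $0$ when $s_\star=0$), $\bar s=\lceil s_\star+\zeta\rceil$ and $\underline\kappa=\min(\underline\kappa_1,\underline\kappa_1(\bar s))$. **Theorem.** There is a universal constant $A\in(0,\infty)$ such that for all $c_1,c_2>0$ and $c_3\ge c_4>0$ there are a finite constant $M_0>2$ and an integer $d_0$, both depending only on $(c_1,c_2,c_3,c_4)$, such that in the setting above (in particular under (H2)), whenever $d\ge d_0$, $\underline\kappa>0$ and $$n\ \ge\ A\,\|X\|_\infty^4\Big(\frac{s_\star}{\underline\kappa}\Big)^2\log d,$$ one has 1. $\displaystyle \mathbb E^{(n)}\big[\check\Pi_{n,d}\big(\{\theta\in\mathbb R^d:\|\theta\|_0\ge\zeta\}\mid Z\big)\big]\le\frac4d$;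 2. $\displaystyle \mathbb E^{(n)}\Big[\check\Pi_{n,d}\Big(\Big\{\theta\in\mathbb R^d:\|\theta-\theta_\star\|_2>\frac{M_0\|X\|_\infty}{\underline\kappa_1(\bar s)}\sqrt{\frac{\bar s\log d}{n}}\Big\}\,\Big|\,Z\Big)\Big]\le\frac{12}d$. -/

import Mathlib

open MeasureTheory ProbabilityTheory
open scoped ENNReal

noncomputable section

namespace SparseLogit

/-- The set of non-zero coordinates of `θ`. Elements `δ` of `{0,1}^d` are represented throughout by
the finite set `{j | δ_j = 1}`, so this is the sparsity structure of `θ`. -/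
def supp {d : ℕ} (θ : Fin d → ℝ) : Finset (Fin d) :=
  Finset.univ.filter fun j => 0 < |θ j|

/-- `‖θ‖₀`, the number of non-zero coordinates. -/
def l0norm {d : ℕ} (θ : Fin d → ℝ) : ℕ := (supp θ).card

/-- The Euclidean norm `‖θ‖₂`. -/
def l2norm {d : ℕ} (θ : Fin d → ℝ) : ℝ := ‖(WithLp.toLp 2 θ : EuclideanSpace ℝ (Fin d))‖

/-- `‖X‖_∞ = max_{i,j} |X_{ij}|`. -/
def maxNorm {n d : ℕ} (X : Matrix (Fin n) (Fin d) ℝ) : ℝ :=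
  ⨆ p : Fin n × Fin d, |X p.1 p.2|

/-- `g(x) = log(1 + e^x)`. -/
def g (x : ℝ) : ℝ := Real.log (1 + Real.exp x)

/-- The logistic likelihood `q_{n,θ}(z) = exp(∑ i, (z_i ⟨x_i, θ⟩ - g(⟨x_i, θ⟩)))`, where `x_i` is the
`i`-th row of `X`. -/
def likelihood {n d : ℕ} (X : Matrix (Fin n) (Fin d) ℝ) (θ : Fin d → ℝ) (z : Fin n → ℝ) : ℝ :=
  Real.exp (∑ i, (z i * (X i ⬝ᵥ θ) - g (X i ⬝ᵥ θ)))

/-- The Laplace distribution with parameter `ρ`: density `(ρ/2) e^{-ρ|x|}`. -/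
def laplace (ρ : ℝ) : Measure ℝ :=
  volume.withDensity fun x => ENNReal.ofReal (ρ / 2 * Real.exp (-ρ * |x|))

/-- The spike-and-slab conditional prior `Π(dθ | δ)`: independent coordinates, Laplace on `δ`, and a
Dirac mass at `0` off `δ`. -/
def condPrior {d : ℕ} (ρ : ℝ) (δ : Finset (Fin d)) : Measure (Fin d → ℝ) :=
  Measure.pi fun j => if j ∈ δ then laplace ρ else Measure.dirac 0

/-- The prior `Π = ∑_δ π_δ Π(· | δ)`. -/
def prior {d : ℕ} (ρ : ℝ) (w : Finset (Fin d) → ℝ) : Measure (Fin d → ℝ) :=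
  ∑ δ : Finset (Fin d), ENNReal.ofReal (w δ) • condPrior ρ δ

/-- The posterior distribution given data `z`: the prior reweighted by the likelihood and
normalized. -/
def posterior {n d : ℕ} (X : Matrix (Fin n) (Fin d) ℝ) (ρ : ℝ) (w : Finset (Fin d) → ℝ)
    (z : Fin n → ℝ) : Measure (Fin d → ℝ) :=
  (∫⁻ θ, ENNReal.ofReal (likelihood X θ z) ∂(prior ρ w))⁻¹ •
    (prior ρ w).withDensity fun θ => ENNReal.ofReal (likelihood X θ z)

/-- The prior weights are `π_δ = h_{|δ|} / binom(d, |δ|)` for a probability distribution `h` on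
`{0, …, d}` with `(c₁ / d^{c₃}) h_{s-1} ≤ h_s ≤ (c₂ / d^{c₄}) h_{s-1}` for `s = 1, …, d`. -/
def SparsePrior (d : ℕ) (c₁ c₂ c₃ c₄ : ℝ) (w : Finset (Fin d) → ℝ) : Prop :=
  ∃ h : ℕ → ℝ,
    (∀ s ≤ d, 0 ≤ h s) ∧ (∑ s ∈ Finset.range (d + 1), h s = 1) ∧
    (∀ s, 1 ≤ s → s ≤ d →
      c₁ / (d : ℝ) ^ c₃ * h (s - 1) ≤ h s ∧ h s ≤ c₂ / (d : ℝ) ^ c₄ * h (s - 1)) ∧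
    ∀ δ : Finset (Fin d), w δ = h δ.card / (d.choose δ.card : ℝ)

/-- `Z_1, …, Z_n` are independent `0`-`1` random variables which follow the logistic regression model
with design matrix `X` and parameter `θs`. -/
structure LogisticModel {Ω : Type*} [MeasurableSpace Ω] (P : Measure Ω) {n d : ℕ}
    (X : Matrix (Fin n) (Fin d) ℝ) (θs : Fin d → ℝ) (Z : Fin n → Ω → ℝ) : Prop where
  measurable : ∀ i, Measurable (Z i)
  binary : ∀ i ω, Z i ω = 0 ∨ Z i ω = 1
  indep : iIndepFun Z P
  prob_one : ∀ i, P {ω | Z i ω = 1} =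
    ENNReal.ofReal (Real.exp (X i ⬝ᵥ θs) / (1 + Real.exp (X i ⬝ᵥ θs)))

/-- The diagonal matrix `W` with entries `g''(⟨x_i, θs⟩)`. -/
def weight {n d : ℕ} (X : Matrix (Fin n) (Fin d) ℝ) (θs : Fin d → ℝ) : Matrix (Fin n) (Fin n) ℝ :=
  Matrix.diagonal fun i => deriv (deriv g) (X i ⬝ᵥ θs)

/-- The quotient `θ' M θ / (n ‖θ‖₂²)`. -/
def quotient {d : ℕ} (n : ℕ) (M : Matrix (Fin d) (Fin d) ℝ) (θ : Fin d → ℝ) : ℝ :=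
  (θ ⬝ᵥ M.mulVec θ) / (n * l2norm θ ^ 2)

/-- `κ₁`, the infimum of `θ'(X'WX)θ / (n‖θ‖₂²)` over `θ ≠ 0` with
`‖θ·δ⋆ᶜ‖₁ ≤ 7 ‖θ·δ⋆‖₁`. It takes values in the extended reals because there is no such `θ` when
`θs = 0`; the infimum is then `+∞`. -/
def kappa {n d : ℕ} (X : Matrix (Fin n) (Fin d) ℝ) (θs : Fin d → ℝ) : EReal :=
  ⨅ θ ∈ {θ : Fin d → ℝ | θ ≠ 0 ∧ ∑ j ∈ (supp θs)ᶜ, |θ j| ≤ 7 * ∑ j ∈ supp θs, |θ j|},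
    ((quotient n (X.transpose * weight X θs * X) θ : ℝ) : EReal)

/-- `κ₁(s)`, the infimum of `θ'(X'WX)θ / (n‖θ‖₂²)` over `1 ≤ ‖θ‖₀ ≤ s`. -/
def kappaSparse {n d : ℕ} (X : Matrix (Fin n) (Fin d) ℝ) (θs : Fin d → ℝ) (s : ℕ) : ℝ :=
  sInf (quotient n (X.transpose * weight X θs * X) '' {θ | 1 ≤ l0norm θ ∧ l0norm θ ≤ s})

/-- `κ̄₁(s)`, the supremum of `θ'(X'X)θ / (n‖θ‖₂²)` over `1 ≤ ‖θ‖₀ ≤ s`. -/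
def kappaBar {n d : ℕ} (X : Matrix (Fin n) (Fin d) ℝ) (s : ℕ) : ℝ :=
  sSup (quotient n (X.transpose * X) '' {θ | 1 ≤ l0norm θ ∧ l0norm θ ≤ s})

/-- `ρ = 4 ‖X‖_∞ √(n log d)`. -/
def rho {n d : ℕ} (X : Matrix (Fin n) (Fin d) ℝ) : ℝ :=
  4 * maxNorm X * √(n * Real.log d)

/-- The sparsity level `ζ`. When `θs = 0` (so that `kappa` is `+∞`), the bracket is multiplied by
`s⋆ = 0`. -/
def zeta {n d : ℕ} (c₄ : ℝ) (X : Matrix (Fin n) (Fin d) ℝ) (θs : Fin d → ℝ) : ℝ :=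
  l0norm θs + 2 / c₄ + 2 / c₄ *
    (1 + 64 * maxNorm X ^ 2 / (kappa X θs).toReal
      + kappaBar X (l0norm θs) / (64 * maxNorm X ^ 2 * Real.log d ^ 2)
      + Real.log (4 * Real.exp 1) / Real.log d) * l0norm θs

/-- `s̄ = ⌈s⋆ + ζ⌉`. -/
def sBar {n d : ℕ} (c₄ : ℝ) (X : Matrix (Fin n) (Fin d) ℝ) (θs : Fin d → ℝ) : ℕ :=
  ⌈(l0norm θs : ℝ) + zeta c₄ X θs⌉₊

/-- `κ = min(κ₁, κ₁(s̄))`. -/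
def kappaMin {n d : ℕ} (c₄ : ℝ) (X : Matrix (Fin n) (Fin d) ℝ) (θs : Fin d → ℝ) : EReal :=
  min (kappa X θs) ((kappaSparse X θs (sBar c₄ X θs) : ℝ) : EReal)

end SparseLogit

end

namespace SparseLogit

open Real

lemma hasDerivAt_g (x : ℝ) : HasDerivAt g (sigmoid x) x := by
  have h : HasDerivAt (fun y => 1 + exp y) (exp x) x := (hasDerivAt_exp x).const_add 1
  have h1 : (0 : ℝ) < 1 + exp x := by positivity
  have h2 : sigmoid x = exp x / (1 + exp x) := by
    rw [sigmoid_def, exp_neg]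
    field_simp
    ring
  rw [h2]
  exact h.log h1.ne'

lemma deriv_deriv_g (x : ℝ) : deriv (deriv g) x = sigmoid x * (1 - sigmoid x) := by
  have : deriv g = sigmoid := funext fun y => (hasDerivAt_g y).deriv
  rw [this, deriv_sigmoid]

lemma continuous_g : Continuous g :=
  continuous_iff_continuousAt.2 fun x => (hasDerivAt_g x).continuousAt

lemma g_neg (x : ℝ) : g (-x) = g x - x := by
  unfold g
  have : 1 + exp (-x) = (1 + exp x) / exp x := by
    rw [exp_neg]; field_simp; ring
  rw [this, log_div (by positivity) (by positivity), log_exp]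

/-- The Bregman divergence of `g` between `t + h` and `t`. -/
noncomputable def breg (t h : ℝ) : ℝ := g (t + h) - g t - sigmoid t * h

lemma breg_neg (t h : ℝ) : breg (-t) (-h) = breg t h := by
  unfold breg
  rw [show -t + -h = -(t + h) by ring, g_neg, g_neg, sigmoid_neg]
  ring

lemma hasDerivAt_breg (t h : ℝ) : HasDerivAt (breg t) (sigmoid (t + h) - sigmoid t) h := by
  have h1 : HasDerivAt (fun y => g (t + y)) (sigmoid (t + h)) h := by
    simpa using (hasDerivAt_g (t + h)).comp_const_add t h
  have h2 : HasDerivAt (fun y => sigmoid t * y) (sigmoid t) h := by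
    simpa using (hasDerivAt_id h).const_mul (sigmoid t)
  exact (h1.sub_const (g t)).sub h2

lemma breg_zero (t : ℝ) : breg t 0 = 0 := by simp [breg]

lemma sigmoid_add_sub (t h : ℝ) : sigmoid (t + h) - sigmoid t =
    exp (-t) * (1 - exp (-h)) / ((1 + exp (-t) * exp (-h)) * (1 + exp (-t))) := by
  rw [sigmoid_def, sigmoid_def, neg_add, exp_add]
  have := exp_pos (-t)
  have := exp_pos (-h)
  field_simp
  ring

lemma sigmoid_mul_one_sub (t : ℝ) :
    sigmoid t * (1 - sigmoid t) = exp (-t) / ((1 + exp (-t)) * (1 + exp (-t))) := by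
  rw [sigmoid_def]
  have := exp_pos (-t)
  field_simp
  ring

lemma le_of_hasDerivAt_le {f f' k k' : ℝ → ℝ} (hf : ∀ x, HasDerivAt f (f' x) x)
    (hk : ∀ x, HasDerivAt k (k' x) x) (h0 : f 0 = k 0) (hle : ∀ x, 0 < x → f' x ≤ k' x)
    {x : ℝ} (hx : 0 ≤ x) : f x ≤ k x := by
  have hm : MonotoneOn (fun y => k y - f y) (Set.Ici 0) := by
    refine monotoneOn_of_hasDerivWithinAt_nonneg (f' := fun y => k' y - f' y) (convex_Ici 0)
      (fun y _ => ((hk y).sub (hf y)).continuousAt.continuousWithinAt)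
      (fun y _ => ((hk y).sub (hf y)).hasDerivWithinAt) ?_
    intro y hy
    rw [interior_Ici] at hy
    exact sub_nonneg.2 (hle y hy)
  have := hm (Set.mem_Ici.2 le_rfl) (Set.mem_Ici.2 hx) hx
  simp only [h0, sub_self] at this
  linarith

lemma hasDerivAt_exp_neg (x : ℝ) : HasDerivAt (fun y => exp (-y)) (-exp (-x)) x := by
  simpa using (hasDerivAt_neg x).exp

lemma sq_div_two_add_le (x : ℝ) (hx : 0 ≤ x) : x ^ 2 / (2 + x) ≤ exp (-x) + x - 1 := by
  have hd (y : ℝ) : HasDerivAt (fun y => (2 + y) * exp (-y) + y)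
      (1 * exp (-y) + (2 + y) * (-exp (-y)) + 1) y :=
    (((hasDerivAt_id y).const_add 2).mul (hasDerivAt_exp_neg y)).add (hasDerivAt_id y)
  have key := le_of_hasDerivAt_le (f := fun _ => (2 : ℝ)) (fun y => hasDerivAt_const y 2) hd
    (by simp) (fun y hy => by
      have h1 : (1 + y) * exp (-y) ≤ 1 := by
        have h2 : 1 + y ≤ exp y := by linarith [add_one_le_exp y]
        calc (1 + y) * exp (-y) ≤ exp y * exp (-y) := by gcongr
          _ = 1 := by rw [← exp_add]; simp
      linarith) hx
  rw [div_le_iff₀ (by linarith)]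
  nlinarith

lemma le_breg_of_nonneg (t h : ℝ) (hh : 0 ≤ h) :
    sigmoid t * (1 - sigmoid t) * (h ^ 2 / (2 + h)) ≤ breg t h := by
  set v := sigmoid t * (1 - sigmoid t) with hv
  have hv0 : 0 ≤ v := mul_nonneg (sigmoid_nonneg t) (sub_nonneg.2 (sigmoid_le_one t))
  have hd (y : ℝ) : HasDerivAt (fun y => v * (exp (-y) + y - 1)) (v * (-exp (-y) + 1)) y :=
    (((hasDerivAt_exp_neg y).add (hasDerivAt_id y)).sub_const 1).const_mul v
  refine (mul_le_mul_of_nonneg_left (sq_div_two_add_le h hh) hv0).trans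
    (le_of_hasDerivAt_le hd (hasDerivAt_breg t) (by simp [breg_zero]) (fun y hy => ?_) hh)
  rw [sigmoid_add_sub, hv, sigmoid_mul_one_sub, div_mul_eq_mul_div]
  have h1 : exp (-y) ≤ 1 := exp_le_one_iff.2 (by linarith)
  have h2 := exp_pos (-t)
  have h3 := exp_pos (-y)
  rw [show -exp (-y) + 1 = 1 - exp (-y) by ring]
  have h4 : 0 ≤ exp (-t) * (1 - exp (-y)) := mul_nonneg h2.le (by linarith)
  gcongr
  nlinarith

lemma breg_le_of_nonneg (t h : ℝ) (hh : 0 ≤ h) : breg t h ≤ h ^ 2 / 2 := by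
  have hd (y : ℝ) : HasDerivAt (fun y : ℝ => y ^ 2 / 2) y y := by
    have := (hasDerivAt_pow 2 y).div_const 2
    simpa using this
  refine le_of_hasDerivAt_le (hasDerivAt_breg t) hd (by simp [breg_zero]) (fun y hy => ?_) hh
  rw [sigmoid_add_sub]
  have h1 : 1 - y ≤ exp (-y) := by linarith [add_one_le_exp (-y)]
  have h2 := exp_pos (-t)
  have h3 := exp_pos (-y)
  rw [div_le_iff₀ (by positivity)]
  have h4 : exp (-t) * (1 - exp (-y)) ≤ exp (-t) * y := by gcongr; linarith
  have h5 : 0 ≤ y * (1 + exp (-t) * exp (-y) + exp (-t) * exp (-y) * exp (-t)) := by positivity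
  nlinarith

/-- Self-concordance lower bound for the Bregman divergence of `g`. -/
lemma le_breg (t h : ℝ) : sigmoid t * (1 - sigmoid t) * (h ^ 2 / (2 + |h|)) ≤ breg t h := by
  rcases le_total 0 h with hh | hh
  · rw [abs_of_nonneg hh]; exact le_breg_of_nonneg t h hh
  · have := le_breg_of_nonneg (-t) (-h) (by linarith)
    rw [breg_neg, sigmoid_neg] at this
    rw [abs_of_nonpos hh]
    convert this using 1
    ring

lemma breg_le (t h : ℝ) : breg t h ≤ h ^ 2 / 2 := by
  rcases le_total 0 h with hh | hh
  · exact breg_le_of_nonneg t h hh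
  · have := breg_le_of_nonneg (-t) (-h) (by linarith)
    rw [breg_neg] at this
    simpa using this

lemma breg_nonneg (t h : ℝ) : 0 ≤ breg t h := by
  refine le_trans ?_ (le_breg t h)
  have := sigmoid_nonneg t
  have := sub_nonneg.2 (sigmoid_le_one t)
  positivity

end SparseLogit

namespace SparseLogit

open Real

section Pi

variable {ι : Type*} [Fintype ι] {α : ι → Type*} [∀ i, MeasurableSpace (α i)]
  {μ : ∀ i, Measure (α i)} [∀ i, IsProbabilityMeasure (μ i)]

lemma lintegral_pi_prod {f : ∀ i, α i → ℝ≥0∞} (hf : ∀ i, Measurable (f i)) :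
    ∫⁻ x, ∏ i, f i (x i) ∂Measure.pi μ = ∏ i, ∫⁻ y, f i y ∂μ i := by
  rw [lintegral_prod_eq_prod_lintegral_of_indepFun Finset.univ (fun i (x : ∀ i, α i) => f i (x i))
    (iIndepFun_pi fun i => (hf i).aemeasurable) fun i => (hf i).comp (measurable_pi_apply i)]
  refine Finset.prod_congr rfl fun i _ => ?_
  rw [← (measurePreserving_eval μ i).lintegral_comp (hf i)]

lemma pi_withDensity {f : ∀ i, α i → ℝ≥0∞} (hf : ∀ i, Measurable (f i))
    [∀ i, SigmaFinite ((μ i).withDensity (f i))] :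
    Measure.pi (fun i => (μ i).withDensity (f i)) =
      (Measure.pi μ).withDensity fun x => ∏ i, f i (x i) := by
  refine Measure.pi_eq fun s hs => ?_
  rw [withDensity_apply _ (MeasurableSet.univ_pi hs), ← lintegral_indicator (.univ_pi hs)]
  have h : (Set.univ.pi s).indicator (fun x : ∀ i, α i => ∏ i, f i (x i)) =
      fun x => ∏ i, (s i).indicator (f i) (x i) := by
    funext x
    by_cases hx : x ∈ Set.univ.pi s
    · rw [Set.indicator_of_mem hx]
      exact Finset.prod_congr rfl fun i _ => (Set.indicator_of_mem (hx i trivial) _).symm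
    · rw [Set.indicator_of_notMem hx]
      simp only [Set.mem_pi, Set.mem_univ, true_imp_iff, not_forall] at hx
      obtain ⟨i, hi⟩ := hx
      exact (Finset.prod_eq_zero (Finset.mem_univ i) (Set.indicator_of_notMem hi _)).symm
  rw [h, lintegral_pi_prod fun i => (hf i).indicator (hs i)]
  refine Finset.prod_congr rfl fun i _ => ?_
  rw [withDensity_apply _ (hs i), lintegral_indicator (hs i)]

end Pi

lemma lintegral_exp_neg_mul_abs_sub {b : ℝ} (hb : 0 < b) (t : ℝ) :
    ∫⁻ x, ENNReal.ofReal (exp (-b * |x - t|)) = ENNReal.ofReal (2 / b) := by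
  rw [lintegral_sub_right_eq_self (fun x => ENNReal.ofReal (exp (-b * |x|))) t]
  have h : ∫ x : ℝ, exp (-b * |x|) = 2 / b := by
    rw [integral_comp_abs (f := fun x => exp (-b * x)), integral_exp_mul_Ioi (by linarith)]
    simp
    ring
  have hi : Integrable fun x : ℝ => exp (-b * |x|) := by
    by_contra hc
    rw [integral_undef hc] at h
    have : 0 < 2 / b := by positivity
    linarith
  rw [← h, ofReal_integral_eq_lintegral_ofReal hi (ae_of_all _ fun x => (exp_pos _).le)]

variable {ρ : ℝ}

lemma lintegral_laplace {f : ℝ → ℝ≥0∞} (hf : Measurable f) :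
    ∫⁻ x, f x ∂laplace ρ = ∫⁻ x, ENNReal.ofReal (ρ / 2 * exp (-ρ * |x|)) * f x := by
  unfold laplace
  rw [lintegral_withDensity_eq_lintegral_mul _ (by fun_prop) hf]
  rfl

lemma lintegral_laplace_exp (hρ : 0 < ρ) {a : ℝ} (ha : 0 < a) (t : ℝ) :
    ∫⁻ x, ENNReal.ofReal (exp (ρ * |x| - a * ρ * |x - t|)) ∂laplace ρ = ENNReal.ofReal (1 / a) := by
  rw [lintegral_laplace (by fun_prop)]
  have (x : ℝ) : ENNReal.ofReal (ρ / 2 * exp (-ρ * |x|)) *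
      ENNReal.ofReal (exp (ρ * |x| - a * ρ * |x - t|)) =
      ENNReal.ofReal (ρ / 2) * ENNReal.ofReal (exp (-(a * ρ) * |x - t|)) := by
    rw [← ENNReal.ofReal_mul (by positivity), ← ENNReal.ofReal_mul (by positivity), mul_assoc,
      ← exp_add]
    ring_nf
  simp_rw [this]
  rw [lintegral_const_mul _ (by fun_prop), lintegral_exp_neg_mul_abs_sub (by positivity),
    ← ENNReal.ofReal_mul (by positivity)]
  congr 1
  field_simp

lemma isProbabilityMeasure_laplace (hρ : 0 < ρ) : IsProbabilityMeasure (laplace ρ) := by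
  constructor
  have := lintegral_laplace_exp hρ one_pos 0
  simpa using this

lemma map_neg_laplace : (laplace ρ).map (fun x => -x) = laplace ρ := by
  ext s hs
  rw [Measure.map_apply measurable_neg hs, ← lintegral_indicator_one hs,
    ← lintegral_indicator_one (measurable_neg hs),
    lintegral_laplace (measurable_one.indicator hs),
    lintegral_laplace (measurable_one.indicator (measurable_neg hs)),
    ← lintegral_neg_eq_self]
  refine lintegral_congr fun x => ?_
  rw [abs_neg]
  congr 1
  have h : -x ∈ (fun y : ℝ => -y) ⁻¹' s ↔ x ∈ s := by
    change - -x ∈ s ↔ _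
    rw [neg_neg]
  by_cases hx : x ∈ s
  · rw [Set.indicator_of_mem hx, Set.indicator_of_mem (h.2 hx)]; rfl
  · rw [Set.indicator_of_notMem hx, Set.indicator_of_notMem (mt h.1 hx)]

lemma integral_laplace_id : ∫ x, x ∂laplace ρ = 0 := by
  have h : ∫ x, x ∂laplace ρ = -∫ x, x ∂laplace ρ := by
    conv_lhs => rw [← map_neg_laplace, integral_map measurable_neg.aemeasurable (by fun_prop)]
    rw [integral_neg]
  linarith

lemma lintegral_laplace_sq_le (hρ : 0 < ρ) :
    ∫⁻ x, ENNReal.ofReal (x ^ 2) ∂laplace ρ ≤ ENNReal.ofReal (16 / ρ ^ 2) := by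
  have h (x : ℝ) : x ^ 2 ≤ 8 / ρ ^ 2 * exp (ρ * |x| - 1 / 2 * ρ * |x - 0|) := by
    have h1 := quadratic_le_exp_of_nonneg (x := ρ * |x| / 2) (by positivity)
    rw [sub_zero, show ρ * |x| - 1 / 2 * ρ * |x| = ρ * |x| / 2 by ring]
    have h2 : 0 ≤ ρ * |x| / 2 := by positivity
    have h3 : (ρ * |x| / 2) ^ 2 / 2 ≤ exp (ρ * |x| / 2) := by linarith
    calc x ^ 2 = 8 / ρ ^ 2 * ((ρ * |x| / 2) ^ 2 / 2) := by
          rw [div_pow, mul_pow, sq_abs]; field_simp; norm_num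
      _ ≤ _ := by gcongr
  calc ∫⁻ x, ENNReal.ofReal (x ^ 2) ∂laplace ρ
      ≤ ∫⁻ x, ENNReal.ofReal (8 / ρ ^ 2) *
          ENNReal.ofReal (exp (ρ * |x| - 1 / 2 * ρ * |x - 0|)) ∂laplace ρ := by
        refine lintegral_mono fun x => ?_
        rw [← ENNReal.ofReal_mul (by positivity)]
        exact ENNReal.ofReal_le_ofReal (h x)
    _ = ENNReal.ofReal (16 / ρ ^ 2) := by
        rw [lintegral_const_mul _ (by fun_prop), lintegral_laplace_exp hρ (by norm_num),
          ← ENNReal.ofReal_mul (by positivity)]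
        congr 1
        ring

lemma integrable_laplace_sq (hρ : 0 < ρ) : Integrable (fun x : ℝ => x ^ 2) (laplace ρ) := by
  refine ⟨by fun_prop, ?_⟩
  rw [hasFiniteIntegral_iff_ofReal (ae_of_all _ fun x => sq_nonneg x)]
  exact (lintegral_laplace_sq_le hρ).trans_lt ENNReal.ofReal_lt_top

lemma integral_laplace_sq_le (hρ : 0 < ρ) : ∫ x, x ^ 2 ∂laplace ρ ≤ 16 / ρ ^ 2 := by
  rw [← ENNReal.ofReal_le_ofReal_iff (by positivity), ofReal_integral_eq_lintegral_ofReal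
    (integrable_laplace_sq hρ) (ae_of_all _ fun x => sq_nonneg x)]
  exact lintegral_laplace_sq_le hρ

lemma laplace_eq_map_add_withDensity (t : ℝ) :
    laplace ρ = ((laplace ρ).map fun x => x + t).withDensity
      fun x => ENNReal.ofReal (exp (ρ * |x - t| - ρ * |x|)) := by
  ext s hs
  have hm : Measurable (s.indicator fun x => ENNReal.ofReal (exp (ρ * |x - t| - ρ * |x|))) :=
    Measurable.indicator (by fun_prop) hs
  have hm' : Measurable fun y =>
      s.indicator (fun x => ENNReal.ofReal (exp (ρ * |x - t| - ρ * |x|))) (y + t) :=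
    hm.comp (measurable_add_const t)
  rw [withDensity_apply _ hs, ← lintegral_indicator hs, ← lintegral_indicator_one hs,
    lintegral_map hm (by fun_prop),
    lintegral_laplace (measurable_one.indicator hs),
    lintegral_laplace hm',
    ← lintegral_add_right_eq_self _ t]
  refine lintegral_congr fun x => ?_
  by_cases hx : x + t ∈ s
  · simp only [Set.indicator_of_mem hx, Pi.one_apply, mul_one, add_sub_cancel_right]
    rw [← ENNReal.ofReal_mul' (exp_pos _).le, mul_assoc, ← exp_add]
    ring_nf
  · simp [Set.indicator_of_notMem hx]

end SparseLogit

namespace SparseLogit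

open Real

variable {ρ : ℝ} {d : ℕ} {δ : Finset (Fin d)}

/-- One coordinate of the conditional prior. -/
noncomputable def spikeSlab (ρ : ℝ) (δ : Finset (Fin d)) (j : Fin d) : Measure ℝ :=
  if j ∈ δ then laplace ρ else Measure.dirac 0

lemma condPrior_eq_pi : condPrior ρ δ = Measure.pi (spikeSlab ρ δ) := rfl

lemma isProbabilityMeasure_spikeSlab (hρ : 0 < ρ) (j : Fin d) :
    IsProbabilityMeasure (spikeSlab ρ δ j) := by
  have := isProbabilityMeasure_laplace hρ
  unfold spikeSlab
  split_ifs <;> infer_instance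

lemma isProbabilityMeasure_condPrior (hρ : 0 < ρ) : IsProbabilityMeasure (condPrior ρ δ) := by
  have := isProbabilityMeasure_spikeSlab (δ := δ) hρ
  rw [condPrior_eq_pi]
  infer_instance

lemma lintegral_condPrior_exp_le (hρ : 0 < ρ) (t : Fin d → ℝ) :
    ∫⁻ θ, ENNReal.ofReal (exp (ρ * ∑ j, |θ j| - 1 / 8 * ρ * ∑ j, |θ j - t j|)) ∂condPrior ρ δ
      ≤ ENNReal.ofReal (8 ^ δ.card) := by
  have := isProbabilityMeasure_spikeSlab (δ := δ) hρ
  have h (θ : Fin d → ℝ) :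
      ENNReal.ofReal (exp (ρ * ∑ j, |θ j| - 1 / 8 * ρ * ∑ j, |θ j - t j|)) =
      ∏ j, ENNReal.ofReal (exp (ρ * |θ j| - 1 / 8 * ρ * |θ j - t j|)) := by
    rw [← ENNReal.ofReal_prod_of_nonneg fun j _ => (exp_pos _).le, ← exp_sum,
      Finset.sum_sub_distrib, Finset.mul_sum, Finset.mul_sum]
  simp_rw [h]
  rw [condPrior_eq_pi, lintegral_pi_prod (μ := spikeSlab ρ δ)
    (f := fun j x => ENNReal.ofReal (exp (ρ * |x| - 1 / 8 * ρ * |x - t j|)))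
    fun j => by fun_prop]
  calc _ ≤ ∏ j : Fin d, if j ∈ δ then (8 : ℝ≥0∞) else 1 := by
        refine Finset.prod_le_prod' fun j _ => ?_
        unfold spikeSlab
        split_ifs with hj
        · rw [lintegral_laplace_exp hρ (by norm_num)]
          norm_num
        · rw [lintegral_dirac' _ (by fun_prop)]
          rw [← ENNReal.ofReal_one]
          refine ENNReal.ofReal_le_ofReal (exp_le_one_iff.2 ?_)
          have : 0 ≤ 1 / 8 * ρ * |0 - t j| := by positivity
          simp only [abs_zero, mul_zero]
          linarith
    _ = 8 ^ δ.card := by simp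
    _ = _ := by rw [ENNReal.ofReal_pow (by norm_num)]; norm_num

lemma ae_supp_subset (hρ : 0 < ρ) : ∀ᵐ θ ∂condPrior ρ δ, supp θ ⊆ δ := by
  have := isProbabilityMeasure_spikeSlab (δ := δ) hρ
  have h : ∀ᵐ θ ∂condPrior ρ δ, ∀ j, j ∉ δ → θ j = 0 := by
    rw [ae_all_iff]
    intro j
    by_cases hj : j ∈ δ
    · simp [hj]
    · have h1 : ∀ᵐ x ∂spikeSlab ρ δ j, x = 0 := by
        simp only [spikeSlab, hj, if_false]
        exact (ae_dirac_iff (measurableSet_singleton (0 : ℝ))).2 rfl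
      filter_upwards [(measurePreserving_eval (spikeSlab ρ δ) j).quasiMeasurePreserving.ae h1]
        with θ hθ _ using hθ
  filter_upwards [h] with θ hθ j hj
  by_contra hc
  simp [supp, hθ j hc] at hj

lemma le_lintegral_condPrior (hρ : 0 < ρ) {t : Fin d → ℝ} (ht : ∀ j, j ∉ δ → t j = 0)
    {F : (Fin d → ℝ) → ℝ≥0∞} (hF : Measurable F) :
    ENNReal.ofReal (exp (-ρ * ∑ j, |t j|)) * ∫⁻ u, F (u + t) ∂condPrior ρ δ
      ≤ ∫⁻ θ, F θ ∂condPrior ρ δ := by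
  have hp := isProbabilityMeasure_spikeSlab (δ := δ) hρ
  have hp' (j : Fin d) : IsProbabilityMeasure ((spikeSlab ρ δ j).map fun x => x + t j) :=
    Measure.isProbabilityMeasure_map (by fun_prop)
  set f : Fin d → ℝ → ℝ≥0∞ := fun j x => ENNReal.ofReal (exp (ρ * |x - t j| - ρ * |x|)) with hf
  have hfm (j : Fin d) : Measurable (f j) := by simp only [hf]; fun_prop
  have h1 (j : Fin d) : ((spikeSlab ρ δ j).map fun x => x + t j).withDensity (f j) =
      spikeSlab ρ δ j := by
    unfold spikeSlab
    split_ifs with hj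
    · exact (laplace_eq_map_add_withDensity (t j)).symm
    · simp [hf, ht j hj]
  have h2 (j : Fin d) :
      SigmaFinite (((spikeSlab ρ δ j).map fun x => x + t j).withDensity (f j)) := by
    rw [h1]; infer_instance
  have h3 : condPrior ρ δ = ((condPrior ρ δ).map fun u => u + t).withDensity
      fun x => ∏ j, f j (x j) := by
    have h4 := pi_withDensity (μ := fun j => (spikeSlab ρ δ j).map fun x => x + t j) hfm
    simp_rw [h1] at h4
    rw [← Measure.pi_map_pi fun j => by fun_prop] at h4
    exact h4
  conv_rhs => rw [h3]
  have hm : Measurable fun x : Fin d → ℝ => ∏ j, f j (x j) :=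
    Finset.measurable_prod _ fun j _ => (hfm j).comp (measurable_pi_apply j)
  rw [lintegral_withDensity_eq_lintegral_mul _ hm hF,
    lintegral_map (hm.mul hF) (by fun_prop), ← lintegral_const_mul _ (by fun_prop)]
  refine lintegral_mono fun u => ?_
  simp only [Pi.mul_apply, Pi.add_apply]
  refine mul_le_mul_left ?_ _
  simp only [hf]
  rw [← ENNReal.ofReal_prod_of_nonneg fun j _ => (exp_pos _).le, ← exp_sum]
  refine ENNReal.ofReal_le_ofReal (exp_le_exp.2 ?_)
  rw [Finset.mul_sum]
  refine Finset.sum_le_sum fun j _ => ?_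
  have := abs_add_le (u j) (t j)
  rw [add_sub_cancel_right]
  nlinarith

lemma memLp_spikeSlab (hρ : 0 < ρ) (j : Fin d) (c : ℝ) :
    MemLp (fun x => c * x) 2 (spikeSlab ρ δ j) := by
  refine MemLp.const_mul ?_ c
  rw [memLp_two_iff_integrable_sq (by fun_prop)]
  unfold spikeSlab
  split_ifs with hj
  · exact integrable_laplace_sq hρ
  · exact integrable_dirac (by simp)

lemma integral_spikeSlab (j : Fin d) : ∫ x, x ∂spikeSlab ρ δ j = 0 := by
  unfold spikeSlab
  split_ifs with hj
  · exact integral_laplace_id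
  · simp

lemma integral_spikeSlab_sq_le (hρ : 0 < ρ) (j : Fin d) :
    ∫ x, x ^ 2 ∂spikeSlab ρ δ j ≤ if j ∈ δ then 16 / ρ ^ 2 else 0 := by
  unfold spikeSlab
  split_ifs with hj
  · exact integral_laplace_sq_le hρ
  · simp

lemma memLp_dotProduct (hρ : 0 < ρ) (c : Fin d → ℝ) :
    MemLp (fun u => c ⬝ᵥ u) 2 (condPrior ρ δ) := by
  have := isProbabilityMeasure_spikeSlab (δ := δ) hρ
  exact memLp_finsetSum Finset.univ fun j _ =>
    (memLp_spikeSlab hρ j (c j)).comp_measurePreserving (measurePreserving_eval (spikeSlab ρ δ) j)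

lemma integral_dotProduct (hρ : 0 < ρ) (c : Fin d → ℝ) :
    ∫ u, c ⬝ᵥ u ∂condPrior ρ δ = 0 := by
  have := isProbabilityMeasure_spikeSlab (δ := δ) hρ
  simp only [dotProduct]
  rw [integral_finsetSum]
  · refine Finset.sum_eq_zero fun j _ => ?_
    rw [integral_const_mul, condPrior_eq_pi,
      integral_comp_eval (μ := spikeSlab ρ δ) (f := fun x : ℝ => x) (by fun_prop),
      integral_spikeSlab, mul_zero]
  · intro j _
    exact ((memLp_spikeSlab hρ j (c j)).comp_measurePreserving
      (measurePreserving_eval (spikeSlab ρ δ) j)).integrable (by norm_num)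

lemma integral_dotProduct_sq_le (hρ : 0 < ρ) (c : Fin d → ℝ) :
    ∫ u, (c ⬝ᵥ u) ^ 2 ∂condPrior ρ δ ≤ ∑ j ∈ δ, c j ^ 2 * (16 / ρ ^ 2) := by
  have := isProbabilityMeasure_spikeSlab (δ := δ) hρ
  have h1 : ∫ u, (c ⬝ᵥ u) ^ 2 ∂condPrior ρ δ = Var[fun u => c ⬝ᵥ u; condPrior ρ δ] := by
    rw [variance_of_integral_eq_zero (memLp_dotProduct hρ c).aestronglyMeasurable.aemeasurable
      (integral_dotProduct hρ c)]
  have h2 : (fun u : Fin d → ℝ => c ⬝ᵥ u) = ∑ j, fun u => (fun x => c j * x) (u j) := by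
    funext u
    simp [dotProduct]
  rw [h1, h2, condPrior_eq_pi, variance_sum_pi fun j => memLp_spikeSlab hρ j (c j)]
  calc ∑ j, Var[fun x => c j * x; spikeSlab ρ δ j]
      ≤ ∑ j, if j ∈ δ then c j ^ 2 * (16 / ρ ^ 2) else 0 := by
        refine Finset.sum_le_sum fun j _ => ?_
        rw [variance_const_mul, variance_of_integral_eq_zero (by fun_prop) (integral_spikeSlab j)]
        refine (mul_le_mul_of_nonneg_left (integral_spikeSlab_sq_le hρ j) (sq_nonneg _)).trans ?_
        split_ifs <;> simp
    _ = _ := by simp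

lemma ofReal_integral_le_lintegral {α : Type*} [MeasurableSpace α] {μ : Measure α} {f : α → ℝ}
    (hf : Integrable f μ) :
    ENNReal.ofReal (∫ x, f x ∂μ) ≤ ∫⁻ x, ENNReal.ofReal (f x) ∂μ := by
  have h : ∫ x, f x ∂μ ≤ ∫ x, max (f x) 0 ∂μ :=
    integral_mono hf hf.pos_part fun x => le_max_left _ _
  refine (ENNReal.ofReal_le_ofReal h).trans ?_
  rw [ofReal_integral_eq_lintegral_ofReal hf.pos_part (ae_of_all _ fun x => le_max_right _ _)]
  refine lintegral_mono fun x => ?_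
  rcases le_total 0 (f x) with hx | hx
  · rw [max_eq_left hx]
  · rw [max_eq_right hx]; simp

/-- Jensen's inequality for the exponential, in terms of the lower Lebesgue integral. -/
lemma ofReal_exp_integral_le_lintegral {α : Type*} [MeasurableSpace α] {μ : Measure α}
    [IsProbabilityMeasure μ] {f : α → ℝ} (hf : Integrable f μ) :
    ENNReal.ofReal (exp (∫ x, f x ∂μ)) ≤ ∫⁻ x, ENNReal.ofReal (exp (f x)) ∂μ := by
  set c := ∫ x, f x ∂μ with hc
  have hi : Integrable (fun x => exp c * (f x - c + 1)) μ :=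
    ((hf.sub (integrable_const c)).add (integrable_const 1)).const_mul _
  have h1 : ∫ x, exp c * (f x - c + 1) ∂μ = exp c := by
    have hi' : Integrable (fun x => f x - c) μ := hf.sub (integrable_const c)
    rw [integral_const_mul, integral_add hi' (integrable_const 1),
      integral_sub hf (integrable_const c)]
    simp [← hc]
  calc ENNReal.ofReal (exp c) = ENNReal.ofReal (∫ x, exp c * (f x - c + 1) ∂μ) := by rw [h1]
    _ ≤ ∫⁻ x, ENNReal.ofReal (exp c * (f x - c + 1)) ∂μ := ofReal_integral_le_lintegral hi
    _ ≤ _ := by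
      refine lintegral_mono fun x => ENNReal.ofReal_le_ofReal ?_
      calc exp c * (f x - c + 1) ≤ exp c * exp (f x - c) := by
            gcongr; exact add_one_le_exp _
        _ = exp (f x) := by rw [← exp_add]; ring_nf

end SparseLogit

namespace SparseLogit

open Real

variable {n d : ℕ} {X : Matrix (Fin n) (Fin d) ℝ} {θs : Fin d → ℝ} {z : Fin n → ℝ} {ρ : ℝ}

/-- The gradient of the log-likelihood at `θs`. -/
noncomputable def score (X : Matrix (Fin n) (Fin d) ℝ) (θs : Fin d → ℝ) (z : Fin n → ℝ)
    (j : Fin d) : ℝ :=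
  ∑ i, X i j * (z i - sigmoid (X i ⬝ᵥ θs))

/-- The second order remainder of minus the log-likelihood at `θs` in the direction `u`. -/
noncomputable def excess (X : Matrix (Fin n) (Fin d) ℝ) (θs u : Fin d → ℝ) : ℝ :=
  ∑ i, breg (X i ⬝ᵥ θs) (X i ⬝ᵥ u)

lemma likelihood_pos (θ : Fin d → ℝ) : 0 < likelihood X θ z := exp_pos _

lemma likelihood_add (u : Fin d → ℝ) :
    likelihood X (u + θs) z =
      likelihood X θs z * exp (score X θs z ⬝ᵥ u - excess X θs u) := by
  unfold likelihood
  rw [← exp_add]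
  congr 1
  have h : score X θs z ⬝ᵥ u = ∑ i, (z i - sigmoid (X i ⬝ᵥ θs)) * (X i ⬝ᵥ u) := by
    simp only [score, dotProduct, Finset.sum_mul, Finset.mul_sum]
    rw [Finset.sum_comm]
    refine Finset.sum_congr rfl fun i _ => Finset.sum_congr rfl fun j _ => ?_
    ring
  rw [h, excess, ← Finset.sum_sub_distrib, ← Finset.sum_add_distrib]
  refine Finset.sum_congr rfl fun i _ => ?_
  rw [dotProduct_add, breg, add_comm (X i ⬝ᵥ u)]
  ring

lemma continuous_likelihood : Continuous fun θ => likelihood X θ z := by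
  have (i : Fin n) : Continuous fun θ : Fin d → ℝ => X i ⬝ᵥ θ := by
    unfold dotProduct
    fun_prop
  unfold likelihood
  have hg := continuous_g
  fun_prop

lemma excess_le (u : Fin d → ℝ) : excess X θs u ≤ ∑ i, (X i ⬝ᵥ u) ^ 2 / 2 :=
  Finset.sum_le_sum fun _ _ => breg_le _ _

lemma abs_le_maxNorm (i : Fin n) (j : Fin d) : |X i j| ≤ maxNorm X :=
  le_ciSup (f := fun p : Fin n × Fin d => |X p.1 p.2|) (Set.finite_range _).bddAbove (i, j)

lemma maxNorm_nonneg : 0 ≤ maxNorm X := Real.iSup_nonneg fun _ => abs_nonneg _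

lemma notMem_supp {θ : Fin d → ℝ} {j : Fin d} : j ∉ supp θ ↔ θ j = 0 := by
  simp [supp]

lemma le_lintegral_likelihood (hρ : 0 < ρ) (hX : 32 * (n * maxNorm X ^ 2) ≤ ρ ^ 2) :
    ENNReal.ofReal (likelihood X θs z * exp (-ρ * ∑ j, |θs j|) * exp (-(l0norm θs / 4 : ℝ)))
      ≤ ∫⁻ θ, ENNReal.ofReal (likelihood X θ z) ∂condPrior ρ (supp θs) := by
  have hp := isProbabilityMeasure_condPrior (δ := supp θs) hρ
  have hsq (i : Fin n) : Integrable (fun u => (X i ⬝ᵥ u) ^ 2 / 2) (condPrior ρ (supp θs)) :=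
    (memLp_dotProduct hρ (X i)).integrable_sq.div_const 2
  have hlin : Integrable (fun u => score X θs z ⬝ᵥ u) (condPrior ρ (supp θs)) :=
    (memLp_dotProduct hρ (score X θs z)).integrable (by norm_num)
  have hsum : Integrable (fun u => ∑ i, (X i ⬝ᵥ u) ^ 2 / 2) (condPrior ρ (supp θs)) :=
    integrable_finsetSum _ fun i _ => hsq i
  have hint : -(l0norm θs / 4 : ℝ) ≤
      ∫ u, (score X θs z ⬝ᵥ u - ∑ i, (X i ⬝ᵥ u) ^ 2 / 2) ∂condPrior ρ (supp θs) := by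
    rw [integral_sub hlin hsum, integral_dotProduct hρ, integral_finsetSum _ fun i _ => hsq i,
      zero_sub, neg_le_neg_iff]
    calc ∑ i, ∫ u, (X i ⬝ᵥ u) ^ 2 / 2 ∂condPrior ρ (supp θs)
        ≤ ∑ i : Fin n, (l0norm θs * (maxNorm X ^ 2 * (16 / ρ ^ 2))) / 2 := by
          refine Finset.sum_le_sum fun i _ => ?_
          rw [integral_div]
          gcongr
          refine (integral_dotProduct_sq_le hρ (X i)).trans ?_
          refine (Finset.sum_le_card_nsmul _ _ (maxNorm X ^ 2 * (16 / ρ ^ 2)) fun j _ => ?_).trans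
            (le_of_eq (by rw [nsmul_eq_mul]; rfl))
          rw [← sq_abs (X i j)]
          gcongr
          exact abs_le_maxNorm i j
      _ = l0norm θs / 4 * (32 * (n * maxNorm X ^ 2) / ρ ^ 2) := by
          simp; ring
      _ ≤ l0norm θs / 4 * 1 := by
          gcongr
          exact (div_le_one (by positivity)).2 hX
      _ = _ := mul_one _
  have hjen := ofReal_exp_integral_le_lintegral (hlin.sub hsum)
  have hshift := le_lintegral_condPrior (δ := supp θs) hρ (t := θs)
    (fun j hj => notMem_supp.1 hj) (F := fun θ => ENNReal.ofReal (likelihood X θ z))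
    (continuous_likelihood.measurable.ennreal_ofReal)
  refine le_trans ?_ hshift
  rw [mul_comm (likelihood X θs z), mul_assoc, ENNReal.ofReal_mul (exp_pos _).le]
  gcongr
  rw [ENNReal.ofReal_mul (likelihood_pos _).le]
  calc ENNReal.ofReal (likelihood X θs z) * ENNReal.ofReal (exp (-(l0norm θs / 4 : ℝ)))
      ≤ ENNReal.ofReal (likelihood X θs z) * ∫⁻ u, ENNReal.ofReal
          (exp (score X θs z ⬝ᵥ u - ∑ i, (X i ⬝ᵥ u) ^ 2 / 2)) ∂condPrior ρ (supp θs) := by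
        gcongr
        exact (ENNReal.ofReal_le_ofReal (exp_le_exp.2 hint)).trans hjen
    _ ≤ ENNReal.ofReal (likelihood X θs z) * ∫⁻ u, ENNReal.ofReal
          (exp (score X θs z ⬝ᵥ u - excess X θs u)) ∂condPrior ρ (supp θs) := by
        gcongr
        exact excess_le _
    _ = ∫⁻ u, ENNReal.ofReal (likelihood X (u + θs) z) ∂condPrior ρ (supp θs) := by
        rw [← lintegral_const_mul' _ _ ENNReal.ofReal_ne_top]
        refine lintegral_congr fun u => ?_
        rw [likelihood_add, ENNReal.ofReal_mul (likelihood_pos _).le]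

lemma setLIntegral_likelihood_le (hρ : 0 < ρ) {B : Set (Fin d → ℝ)} (hB : MeasurableSet B) {b : ℝ}
    (hb : ∀ θ ∈ B, score X θs z ⬝ᵥ (θ - θs) - excess X θs (θ - θs) + ρ * ∑ j, |θs j|
      - ρ * ∑ j, |θ j| ≤ b - 1 / 8 * ρ * ∑ j, |θ j - θs j|) (δ : Finset (Fin d)) :
    ∫⁻ θ in B, ENNReal.ofReal (likelihood X θ z) ∂condPrior ρ δ ≤
      ENNReal.ofReal (likelihood X θs z * exp (-ρ * ∑ j, |θs j|) * exp b * 8 ^ δ.card) := by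
  set C := likelihood X θs z * exp (-ρ * ∑ j, |θs j|) * exp b with hC
  have hC0 : 0 ≤ C := by have := likelihood_pos (X := X) (z := z) θs; positivity
  calc ∫⁻ θ in B, ENNReal.ofReal (likelihood X θ z) ∂condPrior ρ δ
      ≤ ∫⁻ θ in B, ENNReal.ofReal C *
          ENNReal.ofReal (exp (ρ * ∑ j, |θ j| - 1 / 8 * ρ * ∑ j, |θ j - θs j|)) ∂condPrior ρ δ := by
        refine setLIntegral_mono' hB fun θ hθ => ?_
        rw [← ENNReal.ofReal_mul hC0]
        refine ENNReal.ofReal_le_ofReal ?_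
        have h1 : likelihood X θ z = likelihood X θs z *
            exp (score X θs z ⬝ᵥ (θ - θs) - excess X θs (θ - θs)) := by
          rw [← likelihood_add, sub_add_cancel]
        rw [h1, hC, mul_assoc, mul_assoc, ← exp_add, ← exp_add]
        refine mul_le_mul_of_nonneg_left (exp_le_exp.2 ?_) (likelihood_pos _).le
        linarith [hb θ hθ]
    _ ≤ ∫⁻ θ, ENNReal.ofReal C *
          ENNReal.ofReal (exp (ρ * ∑ j, |θ j| - 1 / 8 * ρ * ∑ j, |θ j - θs j|)) ∂condPrior ρ δ :=
        setLIntegral_le_lintegral _ _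
    _ ≤ _ := by
        rw [lintegral_const_mul' _ _ ENNReal.ofReal_ne_top, ENNReal.ofReal_mul hC0]
        gcongr
        exact lintegral_condPrior_exp_le hρ θs

lemma lintegral_prior {w : Finset (Fin d) → ℝ} (f : (Fin d → ℝ) → ℝ≥0∞) (B : Set (Fin d → ℝ)) :
    ∫⁻ θ in B, f θ ∂prior ρ w =
      ∑ δ, ENNReal.ofReal (w δ) * ∫⁻ θ in B, f θ ∂condPrior ρ δ := by
  unfold prior
  rw [← Measure.restrictₗ_apply, map_sum, lintegral_finsetSum_measure]
  refine Finset.sum_congr rfl fun δ _ => ?_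
  rw [Measure.restrictₗ_apply, Measure.restrict_smul, lintegral_smul_measure, smul_eq_mul]

lemma posterior_le {w : Finset (Fin d) → ℝ} (hρ : 0 < ρ)
    (hX : 32 * (n * maxNorm X ^ 2) ≤ ρ ^ 2) (hw : ∀ δ, 0 ≤ w δ) (hws : 0 < w (supp θs))
    {B : Set (Fin d → ℝ)} (hB : MeasurableSet B) {b : ℝ}
    (hb : ∀ θ ∈ B, score X θs z ⬝ᵥ (θ - θs) - excess X θs (θ - θs) + ρ * ∑ j, |θs j|
      - ρ * ∑ j, |θ j| ≤ b - 1 / 8 * ρ * ∑ j, |θ j - θs j|)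
    {D : Finset (Finset (Fin d))} (hD : ∀ δ, δ ∉ D → condPrior ρ δ B = 0) :
    posterior X ρ w z B ≤
      ENNReal.ofReal (exp (b + l0norm θs / 4) * (∑ δ ∈ D, w δ * 8 ^ δ.card) / w (supp θs)) := by
  set C := likelihood X θs z * exp (-ρ * ∑ j, |θs j|) with hC
  have hC0 : 0 < C := by have := likelihood_pos (X := X) (z := z) θs; positivity
  have hnum : ∫⁻ θ in B, ENNReal.ofReal (likelihood X θ z) ∂prior ρ w ≤
      ENNReal.ofReal (C * exp b * ∑ δ ∈ D, w δ * 8 ^ δ.card) := by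
    rw [lintegral_prior, ← Finset.sum_subset (Finset.subset_univ D), Finset.mul_sum,
      ENNReal.ofReal_sum_of_nonneg]
    · refine Finset.sum_le_sum fun δ _ => ?_
      rw [mul_left_comm, ENNReal.ofReal_mul (hw δ)]
      gcongr
      exact setLIntegral_likelihood_le hρ hB hb δ
    · intro δ _
      have := hw δ
      positivity
    · intro δ _ hδ
      rw [Measure.restrict_eq_zero.2 (hD δ hδ), lintegral_zero_measure, mul_zero]
  have hden : ENNReal.ofReal (w (supp θs) * (C * exp (-(l0norm θs / 4 : ℝ)))) ≤
      ∫⁻ θ, ENNReal.ofReal (likelihood X θ z) ∂prior ρ w := by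
    rw [← setLIntegral_univ, lintegral_prior]
    refine le_trans ?_ (Finset.single_le_sum (fun δ _ => zero_le) (Finset.mem_univ (supp θs)))
    rw [ENNReal.ofReal_mul hws.le, setLIntegral_univ]
    gcongr
    exact le_lintegral_likelihood hρ hX
  unfold posterior
  rw [Measure.smul_apply, withDensity_apply _ hB, smul_eq_mul, mul_comm, ← div_eq_mul_inv]
  have hpos : 0 < w (supp θs) * (C * exp (-(l0norm θs / 4 : ℝ))) := by positivity
  calc _ ≤ ENNReal.ofReal (C * exp b * ∑ δ ∈ D, w δ * 8 ^ δ.card) /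
        ENNReal.ofReal (w (supp θs) * (C * exp (-(l0norm θs / 4 : ℝ)))) :=
        ENNReal.div_le_div hnum hden
    _ = _ := by
        rw [← ENNReal.ofReal_div_of_pos hpos]
        congr 1
        rw [exp_neg, exp_add]
        field_simp

lemma posterior_le_one {w : Finset (Fin d) → ℝ} (B : Set (Fin d → ℝ)) :
    posterior X ρ w z B ≤ 1 := by
  refine (measure_mono (Set.subset_univ B)).trans ?_
  unfold posterior
  rw [Measure.smul_apply, withDensity_apply _ MeasurableSet.univ, setLIntegral_univ, smul_eq_mul]
  exact ENNReal.inv_mul_le_one _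

end SparseLogit

namespace SparseLogit

open Real

variable {n d : ℕ} {X : Matrix (Fin n) (Fin d) ℝ} {θs : Fin d → ℝ} {z : Fin n → ℝ} {ρ : ℝ}

lemma l2norm_sq (u : Fin d → ℝ) : l2norm u ^ 2 = ∑ j, u j ^ 2 := by
  simp [l2norm, EuclideanSpace.norm_sq_eq]

lemma l2norm_nonneg (u : Fin d → ℝ) : 0 ≤ l2norm u := norm_nonneg _

lemma l2norm_pos {u : Fin d → ℝ} (hu : u ≠ 0) : 0 < l2norm u := by
  simpa [l2norm] using hu

/-- The quadratic form `u'(X'WX)u`. -/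
noncomputable def fisher (X : Matrix (Fin n) (Fin d) ℝ) (θs u : Fin d → ℝ) : ℝ :=
  ∑ i, sigmoid (X i ⬝ᵥ θs) * (1 - sigmoid (X i ⬝ᵥ θs)) * (X i ⬝ᵥ u) ^ 2

lemma quotient_weight (u : Fin d → ℝ) :
    quotient n (X.transpose * weight X θs * X) u = fisher X θs u / (n * l2norm u ^ 2) := by
  unfold quotient
  congr 1
  rw [← Matrix.mulVec_mulVec, ← Matrix.mulVec_mulVec, Matrix.dotProduct_mulVec,
    Matrix.vecMul_transpose]
  simp only [weight, fisher, dotProduct, Matrix.mulVec_diagonal, deriv_deriv_g]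
  refine Finset.sum_congr rfl fun i _ => ?_
  simp only [Matrix.mulVec, dotProduct]
  ring

lemma sigmoid_var_nonneg (t : ℝ) : 0 ≤ sigmoid t * (1 - sigmoid t) :=
  mul_nonneg (sigmoid_nonneg t) (sub_nonneg.2 (sigmoid_le_one t))

lemma sigmoid_var_le_one (t : ℝ) : sigmoid t * (1 - sigmoid t) ≤ 1 :=
  mul_le_one₀ (sigmoid_le_one t) (sub_nonneg.2 (sigmoid_le_one t)) (by linarith [sigmoid_nonneg t])

lemma fisher_nonneg (u : Fin d → ℝ) : 0 ≤ fisher X θs u :=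
  Finset.sum_nonneg fun _ _ => mul_nonneg (sigmoid_var_nonneg _) (sq_nonneg _)

lemma quotient_nonneg (u : Fin d → ℝ) : 0 ≤ quotient n (X.transpose * weight X θs * X) u := by
  rw [quotient_weight]
  have := fisher_nonneg (X := X) (θs := θs) u
  positivity

lemma abs_dotProduct_le (i : Fin n) (u : Fin d → ℝ) :
    |X i ⬝ᵥ u| ≤ maxNorm X * ∑ j, |u j| := by
  rw [dotProduct, Finset.mul_sum]
  refine (Finset.abs_sum_le_sum_abs _ _).trans (Finset.sum_le_sum fun j _ => ?_)
  rw [abs_mul]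
  exact mul_le_mul_of_nonneg_right (abs_le_maxNorm i j) (abs_nonneg _)

lemma le_excess (u : Fin d → ℝ) :
    fisher X θs u / (2 + maxNorm X * ∑ j, |u j|) ≤ excess X θs u := by
  unfold fisher excess
  rw [Finset.sum_div]
  refine Finset.sum_le_sum fun i _ => le_trans ?_ (le_breg _ _)
  rw [mul_div_assoc]
  have := sigmoid_var_nonneg (X i ⬝ᵥ θs)
  gcongr
  exact abs_dotProduct_le i u

lemma excess_nonneg (u : Fin d → ℝ) : 0 ≤ excess X θs u :=
  Finset.sum_nonneg fun _ _ => breg_nonneg _ _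

lemma kappaSparse_le {s : ℕ} {u : Fin d → ℝ} (h1 : 1 ≤ l0norm u) (hs : l0norm u ≤ s) :
    kappaSparse X θs s ≤ quotient n (X.transpose * weight X θs * X) u := by
  refine csInf_le ⟨0, ?_⟩ ⟨u, ⟨h1, hs⟩, rfl⟩
  rintro _ ⟨v, -, rfl⟩
  exact quotient_nonneg v

lemma l0norm_pos {u : Fin d → ℝ} (hu : u ≠ 0) : 1 ≤ l0norm u := by
  obtain ⟨j, hj⟩ := Function.ne_iff.1 hu
  exact Finset.card_pos.2 ⟨j, by simpa [supp] using hj⟩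

lemma kappaSparse_mul_le (hn : 0 < n) {s : ℕ} {u : Fin d → ℝ} (hs : l0norm u ≤ s) :
    kappaSparse X θs s * (n * l2norm u ^ 2) ≤ fisher X θs u := by
  rcases eq_or_ne u 0 with rfl | hu
  · have : l2norm (0 : Fin d → ℝ) = 0 := by simp [l2norm]
    rw [this]
    simpa using fisher_nonneg (X := X) (θs := θs) 0
  · have h := kappaSparse_le (X := X) (θs := θs) (l0norm_pos hu) hs
    have := l2norm_pos hu
    rwa [quotient_weight, le_div_iff₀ (by positivity)] at h

lemma kappa_le {u : Fin d → ℝ} (hu : u ≠ 0)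
    (hc : ∑ j ∈ (supp θs)ᶜ, |u j| ≤ 7 * ∑ j ∈ supp θs, |u j|) :
    kappa X θs ≤ ((quotient n (X.transpose * weight X θs * X) u : ℝ) : EReal) :=
  iInf₂_le u ⟨hu, hc⟩

lemma kappa_toReal_mul_le (hn : 0 < n) (hk : 0 < kappa X θs) {u : Fin d → ℝ} (hu : u ≠ 0)
    (hc : ∑ j ∈ (supp θs)ᶜ, |u j| ≤ 7 * ∑ j ∈ supp θs, |u j|) :
    (kappa X θs).toReal * (n * l2norm u ^ 2) ≤ fisher X θs u := by
  have h := kappa_le (X := X) hu hc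
  have h2 := EReal.toReal_le_toReal h (ne_bot_of_gt hk) (EReal.coe_ne_top _)
  have := l2norm_pos hu
  rwa [EReal.toReal_coe, quotient_weight, le_div_iff₀ (by positivity)] at h2

lemma supp_mem_cone (hs : l0norm θs ≠ 0) :
    θs ≠ 0 ∧ ∑ j ∈ (supp θs)ᶜ, |θs j| ≤ 7 * ∑ j ∈ supp θs, |θs j| := by
  constructor
  · rintro rfl
    simp [l0norm, supp] at hs
  · rw [Finset.sum_eq_zero fun j hj => by
      rw [notMem_supp.1 (Finset.mem_compl.1 hj), abs_zero]]
    positivity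

lemma kappa_ne_top (hs : l0norm θs ≠ 0) : kappa X θs ≠ ⊤ :=
  ne_top_of_le_ne_top (EReal.coe_ne_top _)
    (kappa_le (supp_mem_cone hs).1 (supp_mem_cone hs).2)

lemma kappa_toReal_pos (hs : l0norm θs ≠ 0) (hk : 0 < kappa X θs) :
    0 < (kappa X θs).toReal :=
  EReal.toReal_pos hk (kappa_ne_top hs)

lemma kappaSparse_le_maxNorm_sq (hd : 0 < d) {s : ℕ} (hs : 1 ≤ s) (hk : 0 < kappaSparse X θs s) :
    0 < n ∧ kappaSparse X θs s ≤ maxNorm X ^ 2 := by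
  set j : Fin d := ⟨0, hd⟩
  set u : Fin d → ℝ := Pi.single j 1 with hu
  have hsupp : supp u = {j} := by
    ext i
    by_cases hi : i = j
    · subst hi; simp [supp, hu]
    · simp [supp, hu, hi]
  have h0 : l0norm u = 1 := by simp [l0norm, hsupp]
  have h2 : l2norm u = 1 := by simp [l2norm, hu]
  have h := kappaSparse_le (X := X) (θs := θs) h0.ge (h0.le.trans hs)
  rw [quotient_weight, h2] at h
  have hn : 0 < n := by
    rcases Nat.eq_zero_or_pos n with rfl | hn
    · simp at h; linarith
    · exact hn
  refine ⟨hn, h.trans ?_⟩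
  have hn' : (0 : ℝ) < n := by exact_mod_cast hn
  rw [one_pow, mul_one, div_le_iff₀ hn', mul_comm]
  refine (Finset.sum_le_card_nsmul _ _ (maxNorm X ^ 2) fun i _ => ?_).trans (by simp)
  have h3 : X i ⬝ᵥ u = X i j := by simp [hu]
  rw [h3, ← sq_abs, ← one_mul (maxNorm X ^ 2)]
  have := abs_le_maxNorm (X := X) i j
  exact mul_le_mul (sigmoid_var_le_one _) (by gcongr) (sq_nonneg _) zero_le_one

lemma sq_sum_abs_le (T : Finset (Fin d)) (u : Fin d → ℝ) :
    (∑ j ∈ T, |u j|) ^ 2 ≤ T.card * l2norm u ^ 2 := by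
  have h : (∑ j ∈ T, |u j|) ^ 2 ≤ T.card * ∑ j ∈ T, |u j| ^ 2 := sq_sum_le_card_mul_sum_sq
  refine h.trans ?_
  rw [l2norm_sq]
  gcongr
  simp only [sq_abs]
  exact Finset.sum_le_sum_of_subset_of_nonneg (Finset.subset_univ T) fun _ _ _ => sq_nonneg _

lemma sum_abs_le_sqrt_mul {s : ℕ} {u : Fin d → ℝ} (hs : l0norm u ≤ s) :
    ∑ j, |u j| ≤ √s * l2norm u := by
  have h1 : ∑ j, |u j| = ∑ j ∈ supp u, |u j| :=
    (Finset.sum_subset (Finset.subset_univ _) fun j _ hj => by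
      rw [notMem_supp.1 hj, abs_zero]).symm
  rw [h1]
  refine abs_le_of_sq_le_sq' ?_ (mul_nonneg (sqrt_nonneg _) (l2norm_nonneg u)) |>.2
  rw [mul_pow, sq_sqrt (Nat.cast_nonneg s)]
  refine (sq_sum_abs_le (supp u) u).trans ?_
  gcongr
  exact hs

lemma l2norm_le_sum_abs (u : Fin d → ℝ) : l2norm u ≤ ∑ j, |u j| := by
  refine abs_le_of_sq_le_sq' ?_ (Finset.sum_nonneg fun _ _ => abs_nonneg _) |>.2
  rw [l2norm_sq, ← Finset.sum_congr rfl fun j _ => sq_abs (u j)]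
  exact Finset.sum_sq_le_sq_sum_of_nonneg fun _ _ => abs_nonneg _

lemma l0norm_sub_le (θ θ' : Fin d → ℝ) : l0norm (θ - θ') ≤ l0norm θ + l0norm θ' := by
  refine (Finset.card_le_card (t := supp θ ∪ supp θ') fun j hj => ?_).trans
    (Finset.card_union_le _ _)
  by_contra hc
  rw [Finset.mem_union, not_or, notMem_supp, notMem_supp] at hc
  exact notMem_supp.2 (by simp [hc.1, hc.2]) hj

/-- The logarithm of the posterior density at `θ`, relative to `θs`. -/
noncomputable def logRatio (X : Matrix (Fin n) (Fin d) ℝ) (ρ : ℝ) (θs : Fin d → ℝ) (z : Fin n → ℝ)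
    (θ : Fin d → ℝ) : ℝ :=
  score X θs z ⬝ᵥ (θ - θs) - excess X θs (θ - θs) + ρ * ∑ j, |θs j| - ρ * ∑ j, |θ j|

lemma logRatio_le (hρ : 0 < ρ) (hG : ∀ j, |score X θs z j| ≤ ρ / 2) (θ : Fin d → ℝ) :
    logRatio X ρ θs z θ ≤ 3 / 2 * ρ * ∑ j ∈ supp θs, |(θ - θs) j|
      - 1 / 2 * ρ * ∑ j ∈ (supp θs)ᶜ, |(θ - θs) j| - excess X θs (θ - θs) := by
  have h1 : score X θs z ⬝ᵥ (θ - θs) ≤ ∑ j, ρ / 2 * |(θ - θs) j| := by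
    refine Finset.sum_le_sum fun j _ => (le_abs_self _).trans ?_
    rw [abs_mul]
    exact mul_le_mul_of_nonneg_right (hG j) (abs_nonneg _)
  have h2 : ∑ j ∈ supp θs, |θs j| - ∑ j ∈ supp θs, |θ j| ≤ ∑ j ∈ supp θs, |(θ - θs) j| := by
    rw [← Finset.sum_sub_distrib]
    refine Finset.sum_le_sum fun j _ => ?_
    rw [Pi.sub_apply, abs_sub_comm]
    exact abs_sub_abs_le_abs_sub _ _
  have h3 : ∑ j ∈ (supp θs)ᶜ, |θs j| = 0 := Finset.sum_eq_zero fun j hj => by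
    rw [notMem_supp.1 (Finset.mem_compl.1 hj), abs_zero]
  have h4 : ∑ j ∈ (supp θs)ᶜ, |θ j| = ∑ j ∈ (supp θs)ᶜ, |(θ - θs) j| :=
    Finset.sum_congr rfl fun j hj => by
      rw [Pi.sub_apply, notMem_supp.1 (Finset.mem_compl.1 hj), sub_zero]
  rw [← Finset.mul_sum, ← Finset.sum_add_sum_compl (supp θs) fun j => |(θ - θs) j|] at h1
  unfold logRatio
  rw [← Finset.sum_add_sum_compl (supp θs) fun j => |θs j|,
    ← Finset.sum_add_sum_compl (supp θs) fun j => |θ j|, h3, h4]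
  nlinarith

lemma cone_bound {N M ℓ s κ a b Q L : ℝ} (hN : 0 < N) (hM : 0 < M) (hℓ : 0 < ℓ) (hs : 0 < s)
    (hκ : 0 < κ) (hA : 12544 * M ^ 4 * (s / κ) ^ 2 * ℓ ≤ N) (ha : 0 ≤ a)
    (hba : b ≤ 7 * a) (hb : 0 ≤ b) (hQ : κ * (N * (a ^ 2 / s)) ≤ Q) (hL : Q / (2 + M * (a + b)) ≤ L) :
    7 * M * √(N * ℓ) * a - L ≤ 64 * M ^ 2 / κ * s * ℓ := by
  set R := √(N * ℓ) with hR
  have hR0 : 0 ≤ R := sqrt_nonneg _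
  have hR2 : R ^ 2 = N * ℓ := sq_sqrt (by positivity)
  have hQ0 : 0 ≤ Q := le_trans (by positivity) hQ
  have hL1 : κ * (N * (a ^ 2 / s)) / (2 + 8 * M * a) ≤ L := by
    refine le_trans ?_ hL
    have : 2 + M * (a + b) ≤ 2 + 8 * M * a := by nlinarith
    gcongr
  have hNκ : 112 * M ^ 2 * s * R ≤ N * κ := by
    refine abs_le_of_sq_le_sq' ?_ (by positivity) |>.2
    have : 12544 * M ^ 4 * (s / κ) ^ 2 * ℓ * (N * κ ^ 2) ≤ N * (N * κ ^ 2) := by gcongr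
    calc (112 * M ^ 2 * s * R) ^ 2 = 12544 * M ^ 4 * s ^ 2 * R ^ 2 := by ring
      _ = 12544 * M ^ 4 * (s / κ) ^ 2 * ℓ * (N * κ ^ 2) := by rw [hR2]; field_simp
      _ ≤ N * (N * κ ^ 2) := this
      _ = _ := by ring
  rcases le_or_gt (4 * M * a) 1 with hc | hc
  · have hL2 : κ * (N * (a ^ 2 / s)) / 4 ≤ L := by
      refine le_trans ?_ hL1
      have : 2 + 8 * M * a ≤ 4 := by linarith
      gcongr
    have h1 : 7 * M * R * a - κ * (N * (a ^ 2 / s)) / 4 ≤ 49 * M ^ 2 / κ * s * ℓ := by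
      have h2 : 49 * M ^ 2 / κ * s * ℓ - (7 * M * R * a - κ * (N * (a ^ 2 / s)) / 4) =
          (14 * M * R * s - κ * N * a) ^ 2 / (4 * κ * N * s) := by
        have h3 : (14 * M * R * s - κ * N * a) ^ 2 =
            196 * M ^ 2 * s ^ 2 * (N * ℓ) - 28 * M * R * s * κ * N * a + κ ^ 2 * N ^ 2 * a ^ 2 := by
          rw [← hR2]; ring
        rw [h3]
        field_simp
        ring
      have h4 : 0 ≤ (14 * M * R * s - κ * N * a) ^ 2 / (4 * κ * N * s) := by positivity
      linarith
    have h5 : 49 * M ^ 2 / κ * s * ℓ ≤ 64 * M ^ 2 / κ * s * ℓ := by gcongr; norm_num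
    linarith
  · have ha' : 0 < a := by
      by_contra hcon
      have : a = 0 := le_antisymm (not_lt.1 hcon) ha
      rw [this] at hc; norm_num at hc
    have hL2 : κ * (N * (a ^ 2 / s)) / (16 * M * a) ≤ L := by
      refine le_trans ?_ hL1
      have : 2 + 8 * M * a ≤ 16 * M * a := by linarith
      gcongr
    have h1 : 7 * M * R * a ≤ κ * (N * (a ^ 2 / s)) / (16 * M * a) := by
      have h2 : κ * (N * (a ^ 2 / s)) / (16 * M * a) = N * κ * (a / (16 * M * s)) := by
        field_simp
      have h3 : 7 * M * R * a = 112 * M ^ 2 * s * R * (a / (16 * M * s)) := by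
        field_simp; ring
      rw [h2, h3]
      gcongr
    have h5 : 0 ≤ 64 * M ^ 2 / κ * s * ℓ := by positivity
    linarith

end SparseLogit

namespace SparseLogit

open Real

variable {n d : ℕ} {X : Matrix (Fin n) (Fin d) ℝ} {θs : Fin d → ℝ} {z : Fin n → ℝ}

lemma rho_pos (hn : 0 < n) (hM : 0 < maxNorm X) (hℓ : 0 < log d) : 0 < rho X := by
  have : (0 : ℝ) < n := by exact_mod_cast hn
  unfold rho
  positivity

lemma logRatio_le_sub_l1 (hn : 0 < n) (hM : 0 < maxNorm X) (hℓ : 0 < log d)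
    (hk : 0 < kappa X θs)
    (hA : l0norm θs ≠ 0 →
      12544 * maxNorm X ^ 4 * ((l0norm θs : ℝ) / (kappa X θs).toReal) ^ 2 * log d ≤ n)
    (hG : ∀ j, |score X θs z j| ≤ rho X / 2) (θ : Fin d → ℝ) :
    logRatio X (rho X) θs z θ ≤
      64 * maxNorm X ^ 2 / (kappa X θs).toReal * l0norm θs * log d
        - 1 / 4 * rho X * ∑ j, |θ j - θs j| := by
  have hρ := rho_pos hn hM hℓ
  have hn' : (0 : ℝ) < n := by exact_mod_cast hn
  have h1 := logRatio_le hρ hG θ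
  have hsum : ∑ j, |θ j - θs j| =
      ∑ j ∈ supp θs, |(θ - θs) j| + ∑ j ∈ (supp θs)ᶜ, |(θ - θs) j| :=
    (Finset.sum_add_sum_compl (supp θs) fun j => |(θ - θs) j|).symm
  rw [hsum]
  have hL0 := excess_nonneg (X := X) (θs := θs) (θ - θs)
  have hL := le_excess (X := X) (θs := θs) (θ - θs)
  have hκ0 : 0 ≤ (kappa X θs).toReal := EReal.toReal_nonneg hk.le
  have hB0 : 0 ≤ 64 * maxNorm X ^ 2 / (kappa X θs).toReal * l0norm θs * log d := by positivity
  have ha0 : 0 ≤ ∑ j ∈ supp θs, |(θ - θs) j| := Finset.sum_nonneg fun _ _ => abs_nonneg _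
  have hb0 : 0 ≤ ∑ j ∈ (supp θs)ᶜ, |(θ - θs) j| := Finset.sum_nonneg fun _ _ => abs_nonneg _
  rcases le_or_gt (∑ j ∈ (supp θs)ᶜ, |(θ - θs) j|) (7 * ∑ j ∈ supp θs, |(θ - θs) j|) with hc | hc
  · rcases ha0.eq_or_lt' with ha | ha
    · have hb : ∑ j ∈ (supp θs)ᶜ, |(θ - θs) j| = 0 := le_antisymm (by linarith) hb0
      rw [ha, hb] at h1 ⊢
      linarith
    · have hs : l0norm θs ≠ 0 := by
        intro h0
        rw [Finset.card_eq_zero.1 h0] at ha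
        simp at ha
      have hu : θ - θs ≠ 0 := by
        intro h0
        rw [h0] at ha
        simp at ha
      have hs' : (0 : ℝ) < l0norm θs := by exact_mod_cast Nat.pos_of_ne_zero hs
      have hκ := kappa_toReal_pos hs hk
      have hQ : (kappa X θs).toReal * (n * ((∑ j ∈ supp θs, |(θ - θs) j|) ^ 2 / l0norm θs)) ≤
          fisher X θs (θ - θs) := by
        refine le_trans ?_ (kappa_toReal_mul_le hn hk hu hc)
        gcongr
        rw [div_le_iff₀ hs', mul_comm]
        exact sq_sum_abs_le (supp θs) (θ - θs)
      rw [← Finset.sum_add_sum_compl (supp θs) fun j => |(θ - θs) j|] at hL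
      have h2 := cone_bound hn' hM hℓ hs' hκ (hA hs) ha0 hc hb0 hQ hL
      have h3 : 7 / 4 * rho X * ∑ j ∈ supp θs, |(θ - θs) j| =
          7 * maxNorm X * √(n * log d) * ∑ j ∈ supp θs, |(θ - θs) j| := by
        unfold rho; ring
      nlinarith [mul_nonneg hρ.le hb0]
  · nlinarith

lemma far_bound {N M ℓ s S κ κm K M₀ a b U V E L b₀ ρ : ℝ} (hN : 0 < N) (hM : 0 < M) (hℓ : 0 < ℓ)
    (hs : 0 ≤ s) (hS1 : 1 ≤ S) (hsS : s ≤ S) (hκ : 0 < κ) (hκM : κ ≤ M ^ 2)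
    (hκm : 0 < κm) (hκm' : κm ≤ κ) (hA : 12544 * M ^ 4 * (s / κm) ^ 2 * ℓ ≤ N)
    (hρ : ρ = 4 * M * √(N * ℓ)) (hK : 0 ≤ K) (hM₀ : M₀ = 11 * (5 + K))
    (hab : a + b = U) (hb : 0 ≤ b) (hVU : V ≤ U) (hUV : U ≤ √S * V)
    (hV : M₀ * M / κ * √(S * ℓ / N) < V) (hL : κ * (N * V ^ 2) / (2 + M * U) ≤ L)
    (hE : E ≤ 3 / 2 * ρ * a - 1 / 2 * ρ * b - L) (hE' : E ≤ b₀ - 1 / 4 * ρ * U)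
    (hb₀ : b₀ ≤ 64 * M ^ 2 / κm * s * ℓ) :
    E ≤ -(K * (1 + s) * ℓ) - 1 / 8 * ρ * U := by
  set R := √(N * ℓ) with hR
  have hR0 : 0 < R := sqrt_pos.2 (by positivity)
  have hR2 : R ^ 2 = N * ℓ := sq_sqrt (by positivity)
  have hρ0 : 0 < ρ := by rw [hρ]; positivity
  have hM₀0 : 0 < M₀ := by rw [hM₀]; positivity
  have hS0 : 0 < S := by linarith
  set q := √S with hq
  have hq2 : q ^ 2 = S := sq_sqrt hS0.le
  have hq1 : 1 ≤ q := one_le_sqrt.2 hS1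
  have hr : √(S * ℓ / N) = q * R / N := by
    rw [show S * ℓ / N = S * (N * ℓ) / N ^ 2 by field_simp, sqrt_div' _ (by positivity),
      sqrt_sq hN.le, sqrt_mul hS0.le]
  rw [hr] at hV
  have hV0 : 0 < V := lt_trans (by positivity) hV
  have hU0 : 0 < U := by linarith
  have hMκ : 1 ≤ M ^ 2 / κ := (one_le_div hκ).2 hκM
  have hMκm : 1 ≤ M ^ 2 / κm := (one_le_div hκm).2 (hκm'.trans hκM)
  have hρV : 4 * M₀ * q * ℓ ≤ ρ * V := by
    calc 4 * M₀ * q * ℓ ≤ 4 * M₀ * q * ℓ * (M ^ 2 / κ) := le_mul_of_one_le_right (by positivity) hMκ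
      _ = 4 * M * R * (M₀ * M / κ * (q * R / N)) := by
          rw [show 4 * M * R * (M₀ * M / κ * (q * R / N)) = 4 * M ^ 2 * M₀ / κ * q * (R ^ 2 / N) by
            ring, hR2]
          field_simp
      _ ≤ 4 * M * R * V := by gcongr
      _ = ρ * V := by rw [hρ]
  rcases le_or_gt (M * U) (3 + K) with hc | hc
  · have h1 : M₀ * ρ * q / 4 ≤ κ * N * V := by
      calc M₀ * ρ * q / 4 = κ * N * (M₀ * M / κ * (q * R / N)) := by
            rw [hρ]; field_simp
        _ ≤ _ := by gcongr
    have h2 : 11 / 4 * ρ * (q * V) ≤ L := by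
      refine le_trans ?_ hL
      rw [le_div_iff₀ (by positivity)]
      calc 11 / 4 * ρ * (q * V) * (2 + M * U) ≤ 11 / 4 * ρ * (q * V) * (2 + (3 + K)) := by gcongr
        _ = M₀ * ρ * q / 4 * V := by rw [hM₀]; ring
        _ ≤ κ * N * V * V := by gcongr
        _ = _ := by ring
    have h3 : E ≤ 3 / 2 * ρ * U - L := by
      have : ρ * U = ρ * a + ρ * b := by rw [← hab]; ring
      linarith [mul_nonneg hρ0.le hb]
    have h4 : ρ * U ≤ ρ * (q * V) := by gcongr
    have h5 : 4 * M₀ * S * ℓ ≤ ρ * (q * V) := by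
      calc 4 * M₀ * S * ℓ = q * (4 * M₀ * q * ℓ) := by rw [← hq2]; ring
        _ ≤ q * (ρ * V) := by gcongr
        _ = _ := by ring
    have h6 : K * (1 + s) * ℓ ≤ 4 * M₀ * S * ℓ := by
      refine mul_le_mul_of_nonneg_right ?_ hℓ.le
      have h7 : K * (1 + s) ≤ K * (2 * S) := by gcongr; linarith
      have h8 : 0 ≤ K * S := by positivity
      have h9 : 4 * M₀ * S = 220 * S + 44 * (K * S) := by rw [hM₀]; ring
      linarith
    have h7 : 0 ≤ ρ * (q * V) := by positivity
    linarith
  · have h1 : 112 * M ^ 2 / κm * s * ℓ ≤ R := by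
      refine abs_le_of_sq_le_sq' ?_ hR0.le |>.2
      rw [hR2]
      calc (112 * M ^ 2 / κm * s * ℓ) ^ 2 = 12544 * M ^ 4 * (s / κm) ^ 2 * ℓ * ℓ := by ring
        _ ≤ N * ℓ := by gcongr
    have h2 : (28 * (3 + K)) * (M ^ 2 / κm * s * ℓ) ≤ 1 / 16 * ρ * U := by
      calc (28 * (3 + K)) * (M ^ 2 / κm * s * ℓ) = (3 + K) * (112 * M ^ 2 / κm * s * ℓ) / 4 := by ring
        _ ≤ (3 + K) * R / 4 := by gcongr
        _ ≤ (M * U) * R / 4 := by gcongr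
        _ = _ := by rw [hρ]; ring
    have h3 : K * ℓ ≤ 1 / 16 * ρ * U := by
      have h4 : 4 * M₀ * 1 * ℓ ≤ 4 * M₀ * q * ℓ := by gcongr
      have h5 : ρ * V ≤ ρ * U := by gcongr
      have h6 : K * ℓ ≤ M₀ * ℓ / 4 := by
        rw [hM₀]; linarith [mul_nonneg hK hℓ.le]
      linarith
    have h4 : K * (s * ℓ) ≤ K * (M ^ 2 / κm * s * ℓ) := by
      gcongr
      exact le_mul_of_one_le_left (by positivity) hMκm
    have h5 : 0 ≤ M ^ 2 / κm * s * ℓ := by positivity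
    have h6 : b₀ ≤ 64 * (M ^ 2 / κm * s * ℓ) := hb₀.trans (le_of_eq (by ring))
    have h7 : 0 ≤ K * (M ^ 2 / κm * s * ℓ) := by positivity
    linarith

lemma kappaBar_nonneg (s : ℕ) : 0 ≤ kappaBar X s := by
  refine Real.sSup_nonneg ?_
  rintro _ ⟨u, -, rfl⟩
  unfold quotient
  refine div_nonneg ?_ (by positivity)
  rw [← Matrix.mulVec_mulVec, Matrix.dotProduct_mulVec, Matrix.vecMul_transpose]
  exact Finset.sum_nonneg fun i _ => mul_self_nonneg _

lemma zeta_ge (c₄ : ℝ) (hc₄ : 0 < c₄) (hk : 0 < kappa X θs) :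
    (l0norm θs : ℝ) + 2 / c₄ ≤ zeta c₄ X θs := by
  have hκ0 : 0 ≤ (kappa X θs).toReal := EReal.toReal_nonneg hk.le
  have hκb := kappaBar_nonneg (X := X) (l0norm θs)
  have h4 : 0 ≤ log (4 * exp 1) := log_nonneg (by nlinarith [add_one_le_exp (1 : ℝ)])
  unfold zeta
  have : 0 ≤ 2 / c₄ * (1 + 64 * maxNorm X ^ 2 / (kappa X θs).toReal
      + kappaBar X (l0norm θs) / (64 * maxNorm X ^ 2 * log d ^ 2)
      + log (4 * exp 1) / log d) * l0norm θs := by positivity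
  linarith

/-- Off a small ball, vectors of low dimension have a posterior density that is small relative to
the one at `θs`. -/
lemma logRatio_le_of_far {c₄ K : ℝ} (hc₄ : 0 < c₄) (hK : 0 ≤ K) (hℓ : 0 < log d)
    (hn : 0 < n) (hM : 0 < maxNorm X) (hk : 0 < kappaMin c₄ X θs)
    (hκM : kappaSparse X θs (sBar c₄ X θs) ≤ maxNorm X ^ 2)
    (hA : 12544 * maxNorm X ^ 4 * ((l0norm θs : ℝ) / (kappaMin c₄ X θs).toReal) ^ 2 * log d ≤ n)
    (hG : ∀ j, |score X θs z j| ≤ rho X / 2) {θ : Fin d → ℝ}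
    (hθ : (l0norm θ : ℝ) < zeta c₄ X θs)
    (hfar : 11 * (5 + K) * maxNorm X / kappaSparse X θs (sBar c₄ X θs) *
      √((sBar c₄ X θs : ℝ) * log d / n) < l2norm (θ - θs))
    (hE' : logRatio X (rho X) θs z θ ≤
      64 * maxNorm X ^ 2 / (kappa X θs).toReal * l0norm θs * log d
        - 1 / 4 * rho X * ∑ j, |θ j - θs j|) :
    logRatio X (rho X) θs z θ ≤
      -(K * (1 + l0norm θs) * log d) - 1 / 8 * rho X * ∑ j, |θ j - θs j| := by
  have hk1 : 0 < kappa X θs := lt_of_lt_of_le hk (min_le_left _ _)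
  have hk2 : 0 < kappaSparse X θs (sBar c₄ X θs) :=
    EReal.coe_pos.1 (lt_of_lt_of_le hk (min_le_right _ _))
  have hmt : kappaMin c₄ X θs ≠ ⊤ := ne_top_of_le_ne_top (EReal.coe_ne_top _) (min_le_right _ _)
  have hκm := EReal.toReal_pos hk hmt
  have hκm' : (kappaMin c₄ X θs).toReal ≤ kappaSparse X θs (sBar c₄ X θs) := by
    have := EReal.toReal_le_toReal (min_le_right (kappa X θs)
      ((kappaSparse X θs (sBar c₄ X θs) : ℝ) : EReal)) (ne_bot_of_gt hk) (EReal.coe_ne_top _)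
    rwa [EReal.toReal_coe] at this
  have hz := zeta_ge (X := X) (θs := θs) c₄ hc₄ hk1
  have hceil : (l0norm θs : ℝ) + zeta c₄ X θs ≤ sBar c₄ X θs := Nat.le_ceil _
  have h2c : 0 < 2 / c₄ := by positivity
  have hs0 : (0 : ℝ) ≤ l0norm θs := Nat.cast_nonneg _
  have hS1 : (1 : ℝ) ≤ sBar c₄ X θs := by
    have : (0 : ℝ) < sBar c₄ X θs := by linarith
    exact_mod_cast this
  have hu0 : l0norm (θ - θs) ≤ sBar c₄ X θs := by
    have h1 : (l0norm (θ - θs) : ℝ) ≤ l0norm θ + l0norm θs := by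
      exact_mod_cast l0norm_sub_le θ θs
    have : (l0norm (θ - θs) : ℝ) ≤ sBar c₄ X θs := by linarith
    exact_mod_cast this
  have hρ := rho_pos hn hM hℓ
  have hMn := maxNorm_nonneg (X := X)
  refine far_bound (N := n) (M := maxNorm X) (S := sBar c₄ X θs)
    (κ := kappaSparse X θs (sBar c₄ X θs)) (κm := (kappaMin c₄ X θs).toReal) (K := K)
    (by exact_mod_cast hn) hM hℓ hs0 hS1 (by linarith) hk2 hκM hκm hκm' hA rfl hK rfl
    (Finset.sum_add_sum_compl (supp θs) fun j => |(θ - θs) j|)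
    (Finset.sum_nonneg fun _ _ => abs_nonneg _)
    (l2norm_le_sum_abs _) (sum_abs_le_sqrt_mul hu0) hfar ?_ (logRatio_le hρ hG θ) hE' ?_
  · refine le_trans ?_ (le_excess (X := X) (θs := θs) (θ - θs))
    have : 0 ≤ ∑ j, |(θ - θs) j| := Finset.sum_nonneg fun _ _ => abs_nonneg _
    exact div_le_div_of_nonneg_right (kappaSparse_mul_le hn hu0) (by positivity)
  · rcases eq_or_ne (l0norm θs) 0 with h0 | h0
    · simp [h0]
    · have h1 := EReal.toReal_le_toReal (min_le_left (kappa X θs)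
        ((kappaSparse X θs (sBar c₄ X θs) : ℝ) : EReal)) (ne_bot_of_gt hk) (kappa_ne_top h0)
      have h2 : (kappaMin c₄ X θs).toReal ≤ (kappa X θs).toReal := h1
      gcongr

end SparseLogit

namespace SparseLogit

open Real

variable {n d : ℕ} {X : Matrix (Fin n) (Fin d) ℝ} {θs : Fin d → ℝ}
  {Ω : Type*} [MeasurableSpace Ω] {P : Measure Ω} {Z : Fin n → Ω → ℝ}

lemma LogisticModel.integral_eq (hZ : LogisticModel P X θs Z) (i : Fin n) :
    ∫ ω, Z i ω ∂P = sigmoid (X i ⬝ᵥ θs) := by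
  have h1 : Z i = ({ω | Z i ω = 1} : Set Ω).indicator 1 := by
    funext ω
    rcases hZ.binary i ω with h | h <;> simp [Set.indicator, h]
  have hm : MeasurableSet {ω | Z i ω = 1} := hZ.measurable i (measurableSet_singleton 1)
  rw [h1, integral_indicator_one hm, Measure.real, hZ.prob_one, ENNReal.toReal_ofReal (by positivity),
    sigmoid_def, exp_neg]
  field_simp
  ring

variable [IsProbabilityMeasure P]

lemma LogisticModel.measureReal_le (hZ : LogisticModel P X θs Z) (hn : 0 < n)
    (hM : 0 < maxNorm X) (hd : 1 < d) (j : Fin d) {e : ℝ} (he : |e| = 1) :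
    P.real {ω | rho X / 2 ≤ ∑ i, e * (X i j * (Z i ω - sigmoid (X i ⬝ᵥ θs)))} ≤
      1 / (d : ℝ) ^ 2 := by
  have hn' : (0 : ℝ) < n := by exact_mod_cast hn
  have hd' : (1 : ℝ) < d := by exact_mod_cast hd
  have hℓ : 0 < log d := log_pos hd'
  have hind : iIndepFun (fun i ω => e * (X i j * (Z i ω - sigmoid (X i ⬝ᵥ θs)))) P :=
    hZ.indep.comp (fun i x => e * (X i j * (x - sigmoid (X i ⬝ᵥ θs)))) fun i => by fun_prop
  have hmeas (i : Fin n) :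
      Measurable fun ω => e * (X i j * (Z i ω - sigmoid (X i ⬝ᵥ θs))) := by
    have := hZ.measurable i
    fun_prop
  have hsub (i : Fin n) (_ : i ∈ Finset.univ) :
      HasSubgaussianMGF (fun ω => e * (X i j * (Z i ω - sigmoid (X i ⬝ᵥ θs))))
        ((‖maxNorm X - -maxNorm X‖₊ / 2) ^ 2) P := by
    refine hasSubgaussianMGF_of_mem_Icc_of_integral_eq_zero (hmeas i).aemeasurable
      (ae_of_all _ fun ω => ?_) ?_
    · rw [Set.mem_Icc, ← abs_le, abs_mul, he, one_mul, abs_mul, ← mul_one (maxNorm X)]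
      refine mul_le_mul (abs_le_maxNorm i j) ?_ (abs_nonneg _) hM.le
      have h0 := sigmoid_nonneg (X i ⬝ᵥ θs)
      have h1 := sigmoid_le_one (X i ⬝ᵥ θs)
      rcases hZ.binary i ω with h | h <;> rw [h, abs_le] <;> constructor <;> linarith
    · have hint : Integrable (Z i) P :=
        Integrable.of_mem_Icc 0 1 (hZ.measurable i).aemeasurable
          (ae_of_all _ fun ω => by rcases hZ.binary i ω with h | h <;> simp [h])
      rw [integral_const_mul, integral_const_mul, integral_sub hint (integrable_const _),
        hZ.integral_eq]
      simp
  refine (HasSubgaussianMGF.measure_sum_ge_le_of_iIndepFun hind hsub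
    (by have := rho_pos hn hM hℓ; positivity)).trans (le_of_eq ?_)
  have hc : ((‖maxNorm X - -maxNorm X‖₊ / 2 : NNReal) : ℝ) = maxNorm X := by
    rw [NNReal.coe_div, coe_nnnorm, Real.norm_of_nonneg (by linarith)]
    push_cast
    ring
  have hexp : -(rho X / 2) ^ 2 /
      (2 * ((∑ _i : Fin n, (‖maxNorm X - -maxNorm X‖₊ / 2) ^ 2 : NNReal) : ℝ)) =
      -log ((d : ℝ) ^ 2) := by
    rw [Finset.sum_const, nsmul_eq_mul, NNReal.coe_mul, NNReal.coe_pow, hc, log_pow]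
    simp only [rho, Finset.card_univ, Fintype.card_fin, NNReal.coe_natCast]
    have : (4 * maxNorm X * √(n * log d) / 2) ^ 2 = 4 * maxNorm X ^ 2 * (n * log d) := by
      rw [div_pow, mul_pow, mul_pow, sq_sqrt (by positivity)]; ring
    rw [this]
    field_simp
    norm_num
  rw [hexp, exp_neg, exp_log (by positivity), one_div]

lemma LogisticModel.measure_score_gt_le (hZ : LogisticModel P X θs Z) (hn : 0 < n)
    (hM : 0 < maxNorm X) (hd : 1 < d) :
    P {ω | ¬ ∀ j, |score X θs (fun i => Z i ω) j| ≤ rho X / 2} ≤ 2 / (d : ℝ≥0∞) := by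
  have hd' : (0 : ℝ) < d := by exact_mod_cast (by omega : 0 < d)
  set F : Fin d → ℝ → Set Ω := fun j e =>
    {ω | rho X / 2 ≤ ∑ i, e * (X i j * (Z i ω - sigmoid (X i ⬝ᵥ θs)))} with hF
  have hsub : {ω | ¬ ∀ j, |score X θs (fun i => Z i ω) j| ≤ rho X / 2} ⊆
      ⋃ j, (F j 1 ∪ F j (-1)) := by
    intro ω hω
    simp only [Set.mem_ofPred_eq, not_forall, not_le] at hω
    obtain ⟨j, hj⟩ := hω
    refine Set.mem_iUnion.2 ⟨j, ?_⟩
    rcases lt_abs.1 hj with h | h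
    · left
      simp only [hF, Set.mem_ofPred_eq, one_mul]
      exact h.le
    · right
      simp only [hF, Set.mem_ofPred_eq]
      rw [← Finset.mul_sum, neg_one_mul]
      exact h.le
  have hF1 (j : Fin d) (e : ℝ) (he : |e| = 1) : P (F j e) ≤ ENNReal.ofReal (1 / (d : ℝ) ^ 2) := by
    rw [← ofReal_measureReal]
    exact ENNReal.ofReal_le_ofReal (hZ.measureReal_le hn hM hd j he)
  calc _ ≤ P (⋃ j, (F j 1 ∪ F j (-1))) := measure_mono hsub
    _ ≤ ∑ j : Fin d, P (F j 1 ∪ F j (-1)) := measure_iUnion_fintype_le _ _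
    _ ≤ ∑ j : Fin d, ENNReal.ofReal (2 / (d : ℝ) ^ 2) := by
        refine Finset.sum_le_sum fun j _ => (measure_union_le _ _).trans ?_
        refine (add_le_add (hF1 j 1 (by simp)) (hF1 j (-1) (by simp))).trans (le_of_eq ?_)
        rw [← ENNReal.ofReal_add (by positivity) (by positivity)]
        congr 1
        ring
    _ = 2 / (d : ℝ≥0∞) := by
        rw [Finset.sum_const, Finset.card_univ, Fintype.card_fin, nsmul_eq_mul,
          ← ENNReal.ofReal_natCast, ← ENNReal.ofReal_mul hd'.le,
          show (2 : ℝ≥0∞) = ENNReal.ofReal 2 by simp, ← ENNReal.ofReal_div_of_pos hd']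
        congr 1
        field_simp

end SparseLogit

namespace SparseLogit

open Real

section Weights

variable {d : ℕ} {c₁ c₂ c₃ c₄ : ℝ} {h : ℕ → ℝ}

lemma le_pow_mul_of_ratio_le {c : ℝ} (hc : 0 ≤ c)
    (hr : ∀ s, 1 ≤ s → s ≤ d → h s ≤ c * h (s - 1)) {s : ℕ} (m : ℕ) (hm : s + m ≤ d) :
    h (s + m) ≤ c ^ m * h s := by
  induction m with
  | zero => simp
  | succ m ih =>
    calc h (s + (m + 1)) ≤ c * h (s + m) := hr (s + (m + 1)) (by omega) hm
      _ ≤ c * (c ^ m * h s) := by gcongr; exact ih (by omega)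
      _ = _ := by ring

lemma mul_le_of_le_ratio {c : ℝ} (hc : 0 ≤ c)
    (hr : ∀ s, 1 ≤ s → s ≤ d → c * h (s - 1) ≤ h s) {s : ℕ} (m : ℕ) (hm : s + m ≤ d) :
    c ^ m * h s ≤ h (s + m) := by
  induction m with
  | zero => simp
  | succ m ih =>
    calc c ^ (m + 1) * h s = c * (c ^ m * h s) := by ring
      _ ≤ c * h (s + m) := by gcongr; exact ih (by omega)
      _ ≤ h (s + (m + 1)) := hr (s + (m + 1)) (by omega) hm

lemma weight_pos (hd : 0 < d) (hc₁ : 0 < c₁) (hc₂ : 0 < c₂) (h0 : ∀ s ≤ d, 0 ≤ h s)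
    (hsum : ∑ s ∈ Finset.range (d + 1), h s = 1)
    (hr : ∀ s, 1 ≤ s → s ≤ d →
      c₁ / (d : ℝ) ^ c₃ * h (s - 1) ≤ h s ∧ h s ≤ c₂ / (d : ℝ) ^ c₄ * h (s - 1))
    {s : ℕ} (hs : s ≤ d) : 0 < h s := by
  have hd' : (0 : ℝ) < d := by exact_mod_cast hd
  have hz : 0 < h 0 := by
    refine lt_of_le_of_ne (h0 0 (Nat.zero_le d)) fun h00 => ?_
    have : ∑ s ∈ Finset.range (d + 1), h s ≤ 0 := Finset.sum_nonpos fun s hs => by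
      have := le_pow_mul_of_ratio_le (h := h) (d := d) (c := c₂ / (d : ℝ) ^ c₄) (by positivity)
        (fun s h1 h2 => (hr s h1 h2).2) (s := 0) s (by simp at hs; omega)
      simpa [← h00] using this
    linarith
  have := mul_le_of_le_ratio (h := h) (d := d) (c := c₁ / (d : ℝ) ^ c₃) (by positivity)
    (fun s h1 h2 => (hr s h1 h2).1) (s := 0) s (by omega)
  rw [zero_add] at this
  exact lt_of_lt_of_le (by positivity) this

lemma sum_card_eq (p : ℕ → Prop) [DecidablePred p] {w : Finset (Fin d) → ℝ}
    (hw : ∀ δ : Finset (Fin d), w δ = h δ.card / (d.choose δ.card : ℝ)) :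
    ∑ δ with p δ.card, w δ * 8 ^ δ.card = ∑ k ∈ Finset.range (d + 1) with p k, h k * 8 ^ k := by
  rw [Finset.sum_filter, Finset.sum_filter, ← Finset.powerset_univ]
  simp_rw [hw]
  rw [Finset.sum_powerset_apply_card
    (fun k => if p k then h k / (d.choose k : ℝ) * 8 ^ k else 0), Finset.card_univ, Fintype.card_fin]
  refine Finset.sum_congr rfl fun k hk => ?_
  have : (d.choose k : ℝ) ≠ 0 := by
    exact_mod_cast (Nat.choose_pos (by simp at hk; omega)).ne'
  split_ifs
  · rw [nsmul_eq_mul]; field_simp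
  · simp

lemma mul_eight_pow_le (hd : 1 < d) (hc₂ : 0 < c₂) (hdc : 16 * c₂ ≤ (d : ℝ) ^ (c₄ / 2))
    (hr : ∀ s, 1 ≤ s → s ≤ d → h s ≤ c₂ / (d : ℝ) ^ c₄ * h (s - 1)) {s k : ℕ} (hs0 : 0 ≤ h s)
    (hsk : s ≤ k) (hk : k ≤ d) :
    h k * 8 ^ k ≤ h s * 8 ^ s * ((1 / 2) ^ (k - s) * exp (-(c₄ / 2 * log d * (k - s : ℝ)))) := by
  obtain ⟨m, rfl⟩ := Nat.exists_eq_add_of_le hsk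
  have hd' : (0 : ℝ) < d := by exact_mod_cast (by omega : 0 < d)
  set D := (d : ℝ) ^ (c₄ / 2) with hD
  have hD0 : 0 < D := by positivity
  have hDD : (d : ℝ) ^ c₄ = D * D := by rw [hD, ← rpow_add hd']; ring_nf
  have hD1 : exp (-(c₄ / 2 * log d * ((s + m : ℕ) - s : ℝ))) = (1 / D) ^ m := by
    rw [hD, rpow_def_of_pos hd', one_div, ← exp_neg, ← exp_nat_mul]
    push_cast
    ring_nf
  have h1 := le_pow_mul_of_ratio_le (h := h) (d := d) (c := c₂ / (d : ℝ) ^ c₄) (by positivity)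
    hr m hk
  rw [hD1, Nat.add_sub_cancel_left, ← mul_pow]
  calc h (s + m) * 8 ^ (s + m) ≤ (c₂ / (d : ℝ) ^ c₄) ^ m * h s * 8 ^ (s + m) := by gcongr
    _ = h s * 8 ^ s * (8 * (c₂ / (d : ℝ) ^ c₄)) ^ m := by rw [mul_pow]; ring
    _ ≤ _ := by
        refine mul_le_mul_of_nonneg_left (pow_le_pow_left₀ (by positivity) ?_ m) (by positivity)
        rw [hDD, ← mul_div_assoc, div_mul_div_comm, div_le_div_iff₀ (by positivity) (by positivity)]
        nlinarith

lemma sum_half_pow_le (T : Finset ℕ) {s : ℕ} (hT : ∀ k ∈ T, s ≤ k ∧ k ≤ d) :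
    ∑ k ∈ T, (1 / 2 : ℝ) ^ (k - s) ≤ 2 := by
  have hsub : T ⊆ Finset.Ico s (d + 1) := fun k hk => by
    have := hT k hk
    simp; omega
  refine (Finset.sum_le_sum_of_subset_of_nonneg hsub fun _ _ _ => by positivity).trans ?_
  rw [Finset.sum_Ico_eq_sum_range]
  simp only [Nat.add_sub_cancel_left]
  exact sum_geometric_two_le _

lemma sum_large_le (hd : 1 < d) (hc₂ : 0 < c₂) (hc₄ : 0 < c₄)
    (hdc : 16 * c₂ ≤ (d : ℝ) ^ (c₄ / 2))
    (hr : ∀ s, 1 ≤ s → s ≤ d → h s ≤ c₂ / (d : ℝ) ^ c₄ * h (s - 1)) {s : ℕ} (hs0 : 0 ≤ h s)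
    {x : ℝ} (hx : (s : ℝ) ≤ x) :
    ∑ k ∈ Finset.range (d + 1) with (x ≤ ((k : ℕ) : ℝ)), h k * 8 ^ k ≤
      2 * (h s * 8 ^ s) * exp (-(c₄ / 2 * log d * (x - s))) := by
  have hℓ : 0 < log d := log_pos (by exact_mod_cast hd)
  have hT : ∀ k ∈ (Finset.range (d + 1)).filter fun k : ℕ => x ≤ k, s ≤ k ∧ k ≤ d := by
    intro k hk
    rw [Finset.mem_filter, Finset.mem_range] at hk
    refine ⟨by exact_mod_cast hx.trans hk.2, by omega⟩
  calc _ ≤ ∑ k ∈ Finset.range (d + 1) with (x ≤ ((k : ℕ) : ℝ)),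
        h s * 8 ^ s * exp (-(c₄ / 2 * log d * (x - s))) * (1 / 2) ^ (k - s) := by
        refine Finset.sum_le_sum fun k hk => ?_
        refine (mul_eight_pow_le hd hc₂ hdc hr hs0 (hT k hk).1 (hT k hk).2).trans ?_
        rw [mul_assoc (h s * 8 ^ s), mul_comm (exp _)]
        have := (Finset.mem_filter.1 hk).2
        gcongr
    _ ≤ h s * 8 ^ s * exp (-(c₄ / 2 * log d * (x - s))) * 2 := by
        rw [← Finset.mul_sum]
        gcongr
        exact sum_half_pow_le _ hT
    _ = _ := by ring

lemma sum_all_le (hd : 1 < d) (hc₁ : 0 < c₁) (hc₂ : 0 < c₂) (hc₃ : 0 < c₃) (hc₄ : 0 < c₄)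
    (hdc : 16 * c₂ ≤ (d : ℝ) ^ (c₄ / 2)) (hdc₁ : 48 * (1 + 1 / c₁) ≤ d)
    (hr : ∀ s, 1 ≤ s → s ≤ d →
      c₁ / (d : ℝ) ^ c₃ * h (s - 1) ≤ h s ∧ h s ≤ c₂ / (d : ℝ) ^ c₄ * h (s - 1))
    {s : ℕ} (hs : s ≤ d) (hs0 : 0 ≤ h s) :
    exp s * ∑ k ∈ Finset.range (d + 1), h k * 8 ^ k ≤
      2 * h s * exp ((1 + c₃) * s * log d) := by
  have hd' : (0 : ℝ) < d := by exact_mod_cast (by omega : 0 < d)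
  have hd1 : (1 : ℝ) ≤ d := by exact_mod_cast hd.le
  have hD1 : 1 ≤ (d : ℝ) ^ c₃ := one_le_rpow hd1 hc₃.le
  set H := (d : ℝ) ^ c₃ * (1 + 1 / c₁) with hH
  have hH1 : 1 ≤ H := by
    have : 0 < 1 / c₁ := by positivity
    nlinarith
  have hterm : ∀ k ∈ Finset.range s, h k * 8 ^ k ≤ h s * 8 ^ s * H ^ s := by
    intro k hk
    rw [Finset.mem_range] at hk
    obtain ⟨m, rfl⟩ := Nat.exists_eq_add_of_le hk.le
    have h1 := mul_le_of_le_ratio (h := h) (d := d) (c := c₁ / (d : ℝ) ^ c₃) (by positivity)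
      (fun s h1 h2 => (hr s h1 h2).1) m hs
    have h2 : h k ≤ h (k + m) * ((d : ℝ) ^ c₃ / c₁) ^ m := by
      have : c₁ / (d : ℝ) ^ c₃ * ((d : ℝ) ^ c₃ / c₁) = 1 := by field_simp
      calc h k = (c₁ / (d : ℝ) ^ c₃) ^ m * h k * ((d : ℝ) ^ c₃ / c₁) ^ m := by
            rw [mul_right_comm, ← mul_pow, this]; simp
        _ ≤ _ := by gcongr
    calc h k * 8 ^ k ≤ h (k + m) * ((d : ℝ) ^ c₃ / c₁) ^ m * 8 ^ k := by gcongr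
      _ ≤ h (k + m) * H ^ m * 8 ^ k := by
          gcongr
          rw [hH, mul_add, mul_one_div]
          linarith
      _ ≤ h (k + m) * H ^ (k + m) * 8 ^ (k + m) := by
          have h3 : H ^ m ≤ H ^ (k + m) := pow_le_pow_right₀ hH1 (by omega)
          have h4 : (8 : ℝ) ^ k ≤ 8 ^ (k + m) := pow_le_pow_right₀ (by norm_num) (by omega)
          gcongr
      _ = _ := by ring
  have hupper : ∑ k ∈ Finset.Ico s (d + 1), h k * 8 ^ k ≤ 2 * (h s * 8 ^ s) := by
    have := sum_large_le hd hc₂ hc₄ hdc (fun s h1 h2 => (hr s h1 h2).2) hs0 (le_refl (s : ℝ))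
    simp only [sub_self, mul_zero, neg_zero, exp_zero, mul_one] at this
    convert this using 2
    ext k
    simp
    omega
  have hlower : ∑ k ∈ Finset.range s, h k * 8 ^ k ≤ s * (h s * 8 ^ s * H ^ s) := by
    refine (Finset.sum_le_card_nsmul _ _ _ hterm).trans (le_of_eq ?_)
    simp
  have hHs : 1 ≤ H ^ s := one_le_pow₀ hH1
  have htot : ∑ k ∈ Finset.range (d + 1), h k * 8 ^ k ≤ 2 * h s * (16 * H) ^ s := by
    rw [← Finset.sum_range_add_sum_Ico _ (by omega : s ≤ d + 1)]
    have h0 : 0 ≤ h s * 8 ^ s := by positivity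
    have h3 : h s * 8 ^ s * 1 ≤ h s * 8 ^ s * H ^ s := by gcongr
    have h4 : (s : ℝ) + 2 ≤ 2 * 2 ^ s := by
      have : s + 1 ≤ 2 ^ s := Nat.lt_two_pow_self
      have h5 : ((s : ℝ) + 1) ≤ 2 ^ s := by exact_mod_cast this
      have h6 : (1 : ℝ) ≤ 2 ^ s := one_le_pow₀ (by norm_num)
      linarith
    calc _ ≤ (s + 2) * (h s * 8 ^ s * H ^ s) := by linarith
      _ ≤ (2 * 2 ^ s) * (h s * 8 ^ s * H ^ s) := by gcongr
      _ = _ := by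
          have h7 : (16 : ℝ) ^ s = 2 ^ s * 8 ^ s := by rw [← mul_pow]; norm_num
          rw [mul_pow 16 H, h7]; ring
  have hexp : exp ((1 + c₃) * s * log d) = (d * (d : ℝ) ^ c₃) ^ s := by
    rw [rpow_def_of_pos hd', ← exp_log hd', ← exp_add, ← exp_nat_mul, exp_log hd']
    ring_nf
  calc _ ≤ exp s * (2 * h s * (16 * H) ^ s) := by gcongr
    _ = 2 * h s * (exp 1 * (16 * H)) ^ s := by
        rw [mul_pow (exp 1), ← exp_nat_mul, mul_one]; ring
    _ ≤ 2 * h s * (d * (d : ℝ) ^ c₃) ^ s := by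
        refine mul_le_mul_of_nonneg_left (pow_le_pow_left₀ (by positivity) ?_ s) (by positivity)
        have he : exp 1 ≤ 3 := by linarith [exp_one_lt_d9]
        calc exp 1 * (16 * H) ≤ 3 * (16 * H) := by gcongr
          _ = 48 * (1 + 1 / c₁) * (d : ℝ) ^ c₃ := by rw [hH]; ring
          _ ≤ _ := by gcongr
    _ = _ := by rw [hexp]

end Weights

end SparseLogit

namespace SparseLogit

open Real

variable {n d : ℕ} {X : Matrix (Fin n) (Fin d) ℝ} {θs : Fin d → ℝ} {z : Fin n → ℝ}
  {c₁ c₂ c₃ c₄ : ℝ} {w : Finset (Fin d) → ℝ}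

lemma measurable_l0norm : Measurable fun θ : Fin d → ℝ => (l0norm θ : ℝ) := by
  have h : (fun θ : Fin d → ℝ => (l0norm θ : ℝ)) = fun θ => ∑ j, if 0 < |θ j| then 1 else 0 := by
    funext θ
    simp [l0norm, supp, Finset.card_filter]
  rw [h]
  refine Finset.measurable_sum _ fun j _ => ?_
  exact Measurable.ite (measurableSet_lt measurable_const (by fun_prop)) measurable_const
    measurable_const

lemma measurable_l2norm_sub : Measurable fun θ : Fin d → ℝ => l2norm (θ - θs) := by
  unfold l2norm
  fun_prop

lemma log_le_zeta (hc₄ : 0 < c₄) (hℓ : 0 < log d) :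
    log d + (1 + 64 * maxNorm X ^ 2 / (kappa X θs).toReal) * l0norm θs * log d
      + log (4 * exp 1) * l0norm θs ≤ c₄ / 2 * log d * (zeta c₄ X θs - l0norm θs) := by
  have hκb := kappaBar_nonneg (X := X) (l0norm θs)
  have h0 : 0 ≤ log d * (kappaBar X (l0norm θs) / (64 * maxNorm X ^ 2 * log d ^ 2)) *
      l0norm θs := by positivity
  have h1 : c₄ / 2 * log d * (zeta c₄ X θs - l0norm θs) =
      log d + (1 + 64 * maxNorm X ^ 2 / (kappa X θs).toReal) * l0norm θs * log d
      + log (4 * exp 1) * l0norm θs +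
      log d * (kappaBar X (l0norm θs) / (64 * maxNorm X ^ 2 * log d ^ 2)) * l0norm θs := by
    unfold zeta
    generalize 64 * maxNorm X ^ 2 / (kappa X θs).toReal = p
    generalize kappaBar X (l0norm θs) / (64 * maxNorm X ^ 2 * log d ^ 2) = q
    field_simp
    ring
  linarith

lemma two_le_log (hd : 8 ≤ d) : 2 ≤ log d := by
  rw [le_log_iff_exp_le (by positivity)]
  have h1 : exp 2 = exp 1 * exp 1 := by rw [← exp_add]; norm_num
  have h2 := exp_one_lt_d9
  have h3 : (8 : ℝ) ≤ d := by exact_mod_cast hd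
  nlinarith [exp_pos 1]

lemma rho_sq_ge (hℓ : 2 ≤ log d) : 32 * (n * maxNorm X ^ 2) ≤ rho X ^ 2 := by
  have : rho X ^ 2 = 16 * (n * maxNorm X ^ 2) * log d := by
    unfold rho
    rw [mul_pow, mul_pow, sq_sqrt (by positivity)]
    ring
  rw [this]
  nlinarith [mul_nonneg (Nat.cast_nonneg (α := ℝ) n) (sq_nonneg (maxNorm X))]

lemma choose_le_exp (hd : 0 < d) (s : ℕ) : (d.choose s : ℝ) ≤ exp (s * log d) := by
  have h1 : (d.choose s : ℝ) ≤ (d : ℝ) ^ s := by exact_mod_cast Nat.choose_le_pow d s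
  rwa [exp_nat_mul, exp_log (by exact_mod_cast hd)]

lemma l0norm_le (θ : Fin d → ℝ) : l0norm θ ≤ d := by
  exact (Finset.card_le_univ (supp θ)).trans_eq (Fintype.card_fin d)

lemma posterior_large_le (hd : 8 ≤ d) (hc₁ : 0 < c₁) (hc₂ : 0 < c₂) (hc₄ : 0 < c₄)
    (hdc : 16 * c₂ ≤ (d : ℝ) ^ (c₄ / 2)) (hw : SparsePrior d c₁ c₂ c₃ c₄ w)
    (hρ : 0 < rho X) (hk : 0 < kappa X θs)
    (hb : ∀ θ, logRatio X (rho X) θs z θ ≤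
      64 * maxNorm X ^ 2 / (kappa X θs).toReal * l0norm θs * log d
        - 1 / 4 * rho X * ∑ j, |θ j - θs j|) :
    posterior X (rho X) w z {θ | zeta c₄ X θs ≤ (l0norm θ : ℝ)} ≤ 2 / (d : ℝ≥0∞) := by
  obtain ⟨h, h0, hsum, hr, hwh⟩ := hw
  have hd0 : 0 < d := by omega
  have hd' : (0 : ℝ) < d := by exact_mod_cast hd0
  have hℓ := two_le_log hd
  have hpos {s : ℕ} (hs : s ≤ d) : 0 < h s := weight_pos hd0 hc₁ hc₂ h0 hsum hr hs
  have hcard (δ : Finset (Fin d)) : δ.card ≤ d := by simpa using Finset.card_le_univ δ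
  have hchoose (δ : Finset (Fin d)) : (0 : ℝ) < d.choose δ.card := by
    exact_mod_cast Nat.choose_pos (hcard δ)
  have hw0 (δ : Finset (Fin d)) : 0 < w δ := by
    rw [hwh]; exact div_pos (hpos (hcard δ)) (hchoose δ)
  set s := l0norm θs with hs
  have hsd : s ≤ d := l0norm_le θs
  set b := 64 * maxNorm X ^ 2 / (kappa X θs).toReal * s * log d with hbdef
  have hζs : (s : ℝ) ≤ zeta c₄ X θs := by
    have := zeta_ge (X := X) (θs := θs) c₄ hc₄ hk
    have h2 : 0 < 2 / c₄ := by positivity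
    linarith
  have hpost := posterior_le (X := X) (θs := θs) (z := z) (w := w) hρ (rho_sq_ge hℓ)
    (fun δ => (hw0 δ).le) (hw0 _) (B := {θ | zeta c₄ X θs ≤ (l0norm θ : ℝ)})
    (measurableSet_le measurable_const measurable_l0norm) (b := b)
    (fun θ _ => by
      have h1 := hb θ
      have h2 : 0 ≤ rho X * ∑ j, |θ j - θs j| :=
        mul_nonneg hρ.le (Finset.sum_nonneg fun _ _ => abs_nonneg _)
      unfold logRatio at h1
      linarith)
    (D := Finset.univ.filter fun δ => zeta c₄ X θs ≤ (δ.card : ℝ)) (fun δ hδ => by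
      refine measure_eq_zero_iff_ae_notMem.2 ?_
      filter_upwards [ae_supp_subset hρ] with θ hθ hmem
      refine hδ (Finset.mem_filter.2 ⟨Finset.mem_univ _, le_trans hmem ?_⟩)
      exact_mod_cast Finset.card_le_card hθ)
  refine hpost.trans ?_
  rw [show (2 : ℝ≥0∞) / d = ENNReal.ofReal (2 / d) by
    rw [ENNReal.ofReal_div_of_pos hd']; simp]
  refine ENNReal.ofReal_le_ofReal ?_
  rw [sum_card_eq (fun k => zeta c₄ X θs ≤ (k : ℝ)) hwh, hwh]
  have hlarge := sum_large_le (by omega) hc₂ hc₄ hdc (fun s h1 h2 => (hr s h1 h2).2)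
    (hpos hsd).le hζs
  have hhs := hpos hsd
  have hCs := hchoose (supp θs)
  change exp (b + s / 4) * _ / (h s / d.choose s) ≤ _
  change (0 : ℝ) < d.choose s at hCs
  have hexp8 : (8 : ℝ) ^ s = exp (s * log 8) := by rw [exp_nat_mul, exp_log (by norm_num)]
  have hlog : log 8 + 1 / 4 ≤ log (4 * exp 1) := by
    rw [log_mul (by norm_num) (exp_pos 1).ne', log_exp, show (8 : ℝ) = 4 * 2 by norm_num,
      log_mul (by norm_num) (by norm_num)]
    linarith [log_two_lt_d9]
  have hz := log_le_zeta (X := X) (θs := θs) hc₄ (by linarith : 0 < log d)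
  calc exp (b + s / 4) * _ / (h s / d.choose s)
      ≤ exp (b + s / 4) * (2 * (h s * 8 ^ s) *
          exp (-(c₄ / 2 * log d * (zeta c₄ X θs - s)))) / (h s / d.choose s) := by gcongr
    _ = 2 * d.choose s * (exp (b + s / 4) * 8 ^ s *
          exp (-(c₄ / 2 * log d * (zeta c₄ X θs - s)))) := by field_simp
    _ ≤ 2 * exp (s * log d) * (exp (b + s / 4) * 8 ^ s *
          exp (-(c₄ / 2 * log d * (zeta c₄ X θs - s)))) := by
        gcongr
        exact choose_le_exp hd0 s
    _ = 2 * exp (s * log d + (b + s / 4 + s * log 8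
          + -(c₄ / 2 * log d * (zeta c₄ X θs - s)))) := by
        simp only [hexp8, exp_add, mul_assoc]
    _ ≤ 2 * exp (-log d) := by
        gcongr
        have h1 : (log 8 + 1 / 4) * s ≤ log (4 * exp 1) * s := by gcongr
        have h2 : b = 64 * maxNorm X ^ 2 / (kappa X θs).toReal * s * log d := hbdef
        linarith
    _ = 2 / d := by rw [exp_neg, exp_log hd', div_eq_mul_inv]

lemma posterior_far_le (hd : 8 ≤ d) (hc₁ : 0 < c₁) (hc₂ : 0 < c₂) (hc₃ : 0 < c₃) (hc₄ : 0 < c₄)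
    (hdc : 16 * c₂ ≤ (d : ℝ) ^ (c₄ / 2)) (hdc₁ : 48 * (1 + 1 / c₁) ≤ d)
    (hw : SparsePrior d c₁ c₂ c₃ c₄ w) (hρ : 0 < rho X) {B : Set (Fin d → ℝ)}
    (hB : MeasurableSet B)
    (hb : ∀ θ ∈ B, logRatio X (rho X) θs z θ ≤
      -((3 + c₃) * (1 + l0norm θs) * log d) - 1 / 8 * rho X * ∑ j, |θ j - θs j|) :
    posterior X (rho X) w z B ≤ 2 / (d : ℝ≥0∞) := by
  obtain ⟨h, h0, hsum, hr, hwh⟩ := hw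
  have hd0 : 0 < d := by omega
  have hd' : (0 : ℝ) < d := by exact_mod_cast hd0
  have hℓ := two_le_log hd
  have hpos {s : ℕ} (hs : s ≤ d) : 0 < h s := weight_pos hd0 hc₁ hc₂ h0 hsum hr hs
  have hcard (δ : Finset (Fin d)) : δ.card ≤ d := by simpa using Finset.card_le_univ δ
  have hchoose (δ : Finset (Fin d)) : (0 : ℝ) < d.choose δ.card := by
    exact_mod_cast Nat.choose_pos (hcard δ)
  have hw0 (δ : Finset (Fin d)) : 0 < w δ := by
    rw [hwh]; exact div_pos (hpos (hcard δ)) (hchoose δ)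
  set s := l0norm θs with hs
  have hsd : s ≤ d := l0norm_le θs
  set b := -((3 + c₃) * (1 + s) * log d) with hbdef
  have hpost := posterior_le (X := X) (θs := θs) (z := z) (w := w) hρ (rho_sq_ge hℓ)
    (fun δ => (hw0 δ).le) (hw0 _) hB (b := b) hb
    (D := Finset.univ.filter fun _ => True) (fun δ hδ => by simp at hδ)
  refine hpost.trans ?_
  rw [show (2 : ℝ≥0∞) / d = ENNReal.ofReal (2 / d) by
    rw [ENNReal.ofReal_div_of_pos hd']; simp]
  refine ENNReal.ofReal_le_ofReal ?_
  rw [sum_card_eq (fun _ => True) hwh, hwh, Finset.filter_true]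
  have hhs := hpos hsd
  have hCs := hchoose (supp θs)
  have hall := sum_all_le (by omega) hc₁ hc₂ hc₃ hc₄ hdc hdc₁ hr hsd hhs.le
  change exp (b + s / 4) * _ / (h s / d.choose s) ≤ _
  change (0 : ℝ) < d.choose s at hCs
  have hS0 : 0 ≤ ∑ k ∈ Finset.range (d + 1), h k * 8 ^ k := Finset.sum_nonneg fun k hk =>
    mul_nonneg (h0 k (by simp at hk; omega)) (by positivity)
  calc exp (b + s / 4) * _ / (h s / d.choose s)
      ≤ exp (b + s) * (∑ k ∈ Finset.range (d + 1), h k * 8 ^ k) / (h s / d.choose s) := by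
        gcongr
        have : (0 : ℝ) ≤ s := Nat.cast_nonneg s
        linarith
    _ = exp b * (exp s * ∑ k ∈ Finset.range (d + 1), h k * 8 ^ k) / (h s / d.choose s) := by
        rw [exp_add, mul_assoc]
    _ ≤ exp b * (2 * h s * exp ((1 + c₃) * s * log d)) / (h s / d.choose s) := by gcongr
    _ = 2 * d.choose s * (exp b * exp ((1 + c₃) * s * log d)) := by field_simp
    _ ≤ 2 * exp (s * log d) * (exp b * exp ((1 + c₃) * s * log d)) := by
        gcongr
        exact choose_le_exp hd0 s
    _ = 2 * exp (s * log d + (b + (1 + c₃) * s * log d)) := by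
        rw [exp_add, exp_add, mul_assoc]
    _ ≤ 2 * exp (-log d) := by
        gcongr
        have h1 : 0 ≤ c₃ * log d := by positivity
        have h2 : 0 ≤ s * log d := by positivity
        have h3 : b = -(3 * log d + c₃ * log d + 3 * (s * log d) + c₃ * s * log d) := by
          rw [hbdef]; ring
        linarith
    _ = 2 / d := by rw [exp_neg, exp_log hd', div_eq_mul_inv]

lemma lintegral_le_add_measure {Ω : Type*} [MeasurableSpace Ω] {P : Measure Ω}
    [IsProbabilityMeasure P] {f : Ω → ℝ≥0∞} {E : Set Ω} {x : ℝ≥0∞} (hE : MeasurableSet E)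
    (hf1 : ∀ ω, f ω ≤ 1) (hf : ∀ ω, ω ∉ E → f ω ≤ x) : ∫⁻ ω, f ω ∂P ≤ x + P E := by
  calc ∫⁻ ω, f ω ∂P ≤ ∫⁻ ω, (x + E.indicator 1 ω) ∂P := by
        refine lintegral_mono fun ω => ?_
        by_cases hω : ω ∈ E
        · rw [Set.indicator_of_mem hω]
          exact (hf1 ω).trans le_add_self
        · exact (hf ω hω).trans le_self_add
    _ = x + P E := by
        rw [lintegral_add_left measurable_const, lintegral_const, measure_univ, mul_one,
          lintegral_indicator_one hE]

lemma measurableSet_score {Ω : Type*} [MeasurableSpace Ω] {Z : Fin n → Ω → ℝ}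
    (hZ : ∀ i, Measurable (Z i)) (r : ℝ) :
    MeasurableSet {ω | ¬ ∀ j, |score X θs (fun i => Z i ω) j| ≤ r} := by
  have hm (j : Fin d) : Measurable fun ω => |score X θs (fun i => Z i ω) j| := by
    unfold score
    fun_prop
  exact (Measurable.forall fun j => measurableSet_setOfPred.1
    (measurableSet_le (hm j) measurable_const)).setOf.compl

lemma exists_dimension_bound (hc₄ : 0 < c₄) :
    ∃ d₀ : ℕ, ∀ d : ℕ, d₀ ≤ d → 8 ≤ d ∧ 16 * c₂ ≤ (d : ℝ) ^ (c₄ / 2) ∧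
      48 * (1 + 1 / c₁) ≤ (d : ℝ) := by
  have h1 : ∀ᶠ d : ℕ in Filter.atTop, 16 * c₂ ≤ (d : ℝ) ^ (c₄ / 2) :=
    ((tendsto_rpow_atTop (half_pos hc₄)).comp tendsto_natCast_atTop_atTop).eventually_ge_atTop _
  have h2 : ∀ᶠ d : ℕ in Filter.atTop, 48 * (1 + 1 / c₁) ≤ (d : ℝ) :=
    tendsto_natCast_atTop_atTop.eventually_ge_atTop _
  obtain ⟨d₀, hd₀⟩ := Filter.eventually_atTop.1
    ((Filter.eventually_ge_atTop 8).and (h1.and h2))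
  exact ⟨d₀, hd₀⟩

end SparseLogit

theorem theorem2 :
    ∃ A : ℝ, 0 < A ∧
    ∀ c₁ c₂ c₃ c₄ : ℝ, 0 < c₁ → 0 < c₂ → 0 < c₄ → c₄ ≤ c₃ →
    ∃ M₀ : ℝ, 2 < M₀ ∧ ∃ d₀ : ℕ, ∀ d : ℕ, d₀ ≤ d →
    ∀ (n : ℕ) (X : Matrix (Fin n) (Fin d) ℝ) (θs : Fin d → ℝ) (w : Finset (Fin d) → ℝ)
      (Ω : Type*) [MeasurableSpace Ω] (P : Measure Ω) [IsProbabilityMeasure P]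
      (Z : Fin n → Ω → ℝ),
      SparseLogit.LogisticModel P X θs Z →
      SparseLogit.SparsePrior d c₁ c₂ c₃ c₄ w →
      0 < SparseLogit.kappaMin c₄ X θs →
      A * SparseLogit.maxNorm X ^ 4 *
          ((SparseLogit.l0norm θs : ℝ) / (SparseLogit.kappaMin c₄ X θs).toReal) ^ 2 *
          Real.log d ≤ (n : ℝ) →
      (∫⁻ ω, SparseLogit.posterior X (SparseLogit.rho X) w (fun i => Z i ω)
          {θ | SparseLogit.zeta c₄ X θs ≤ (SparseLogit.l0norm θ : ℝ)} ∂P ≤ 4 / (d : ℝ≥0∞)) ∧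
      (∫⁻ ω, SparseLogit.posterior X (SparseLogit.rho X) w (fun i => Z i ω)
          {θ | M₀ * SparseLogit.maxNorm X /
                SparseLogit.kappaSparse X θs (SparseLogit.sBar c₄ X θs) *
                √((SparseLogit.sBar c₄ X θs : ℝ) * Real.log d / n) <
              SparseLogit.l2norm (θ - θs)} ∂P ≤ 12 / (d : ℝ≥0∞)) := by
  refine ⟨12544, by norm_num, fun c₁ c₂ c₃ c₄ hc₁ hc₂ hc₄ hc₃₄ => ?_⟩
  have hc₃ : 0 < c₃ := hc₄.trans_le hc₃₄
  obtain ⟨d₀, hd₀⟩ := SparseLogit.exists_dimension_bound (c₁ := c₁) (c₂ := c₂) hc₄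
  refine ⟨11 * (5 + (3 + c₃)), by linarith, d₀, ?_⟩
  intro d hdd n X θs w Ω _ P _ Z hZ hw hk hA
  obtain ⟨hd, hdc, hdc₁⟩ := hd₀ d hdd
  have hℓ : 0 < Real.log d := by linarith [SparseLogit.two_le_log hd]
  have hk1 : 0 < SparseLogit.kappa X θs := lt_of_lt_of_le hk (min_le_left _ _)
  have hk2 : 0 < SparseLogit.kappaSparse X θs (SparseLogit.sBar c₄ X θs) :=
    EReal.coe_pos.1 (lt_of_lt_of_le hk (min_le_right _ _))
  have hS1 : 1 ≤ SparseLogit.sBar c₄ X θs := by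
    have h1 := SparseLogit.zeta_ge (X := X) (θs := θs) c₄ hc₄ hk1
    have h2 : 0 < 2 / c₄ := by positivity
    have h3 : (0 : ℝ) ≤ SparseLogit.l0norm θs := Nat.cast_nonneg _
    exact Nat.ceil_pos.2 (by linarith)
  obtain ⟨hn, hκM⟩ := SparseLogit.kappaSparse_le_maxNorm_sq (by omega) hS1 hk2
  have hM : 0 < SparseLogit.maxNorm X :=
    lt_of_le_of_ne SparseLogit.maxNorm_nonneg fun h0 => by
      rw [← h0] at hκM
      norm_num at hκM
      linarith
  have hρ := SparseLogit.rho_pos hn hM hℓ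
  have hA' : SparseLogit.l0norm θs ≠ 0 → 12544 * SparseLogit.maxNorm X ^ 4 *
      ((SparseLogit.l0norm θs : ℝ) / (SparseLogit.kappa X θs).toReal) ^ 2 * Real.log d ≤ n := by
    intro h0
    refine le_trans ?_ hA
    have h1 : (SparseLogit.kappaMin c₄ X θs).toReal ≤ (SparseLogit.kappa X θs).toReal :=
      EReal.toReal_le_toReal (min_le_left _ _) (ne_bot_of_gt hk) (SparseLogit.kappa_ne_top h0)
    have h2 : 0 < (SparseLogit.kappaMin c₄ X θs).toReal :=
      EReal.toReal_pos hk (ne_top_of_le_ne_top (EReal.coe_ne_top _) (min_le_right _ _))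
    gcongr
  have hE := SparseLogit.measurableSet_score (X := X) (θs := θs) hZ.measurable
    (SparseLogit.rho X / 2)
  have hPE := hZ.measure_score_gt_le hn hM (by omega)
  have hl1 (ω : Ω) (hω : ∀ j, |SparseLogit.score X θs (fun i => Z i ω) j| ≤
      SparseLogit.rho X / 2) :=
    SparseLogit.logRatio_le_sub_l1 hn hM hℓ hk1 hA' hω
  have hlarge (ω : Ω) (hω : ∀ j, |SparseLogit.score X θs (fun i => Z i ω) j| ≤
      SparseLogit.rho X / 2) :=
    SparseLogit.posterior_large_le hd hc₁ hc₂ hc₄ hdc hw hρ hk1 (hl1 ω hω)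
  constructor
  · refine (SparseLogit.lintegral_le_add_measure hE (fun ω => SparseLogit.posterior_le_one _)
      (fun ω hω => hlarge ω (not_not.1 hω))).trans ((add_le_add_right hPE _).trans ?_)
    rw [← ENNReal.add_div]
    norm_num
  · refine (SparseLogit.lintegral_le_add_measure hE (fun ω => SparseLogit.posterior_le_one _)
      (x := 2 / d + 2 / d) (fun ω hω => ?_)).trans ((add_le_add_right hPE _).trans ?_)
    · have hω' := not_not.1 hω
      refine le_trans (measure_mono fun θ hθ => ?_) ((measure_union_le _ _).trans
        (add_le_add (hlarge ω hω') (SparseLogit.posterior_far_le hd hc₁ hc₂ hc₃ hc₄ hdc hdc₁ hw hρ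
          (B := {θ | (SparseLogit.l0norm θ : ℝ) < SparseLogit.zeta c₄ X θs} ∩
            {θ | 11 * (5 + (3 + c₃)) * SparseLogit.maxNorm X /
                SparseLogit.kappaSparse X θs (SparseLogit.sBar c₄ X θs) *
                √((SparseLogit.sBar c₄ X θs : ℝ) * Real.log d / n) <
              SparseLogit.l2norm (θ - θs)})
          ((measurableSet_lt SparseLogit.measurable_l0norm measurable_const).inter
            (measurableSet_lt measurable_const SparseLogit.measurable_l2norm_sub))
          fun θ hθ => SparseLogit.logRatio_le_of_far hc₄ (by positivity) hℓ hn hM hk hκM hA hω'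
            hθ.1 hθ.2 (hl1 ω hω' θ))))
      rcases le_or_gt (SparseLogit.zeta c₄ X θs) (SparseLogit.l0norm θ : ℝ) with h | h
      · exact Or.inl h
      · exact Or.inr ⟨h, hθ⟩
    · rw [← ENNReal.add_div, ← ENNReal.add_div]
      refine ENNReal.div_le_div_right ?_ _
      norm_num
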